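/- Let $X$ be a compact metrizable space with its Borel $\sigma$-algebra, $\mu_0$ a Borel probability measure on $X$, and let $\mathcal P(X)$ be the space of Borel probability measures on $X$ with the weak topology. For each $N\ge 1$ let $H^{(N)}:X^N\to(-\infty,\infty]$ be a measurable function, symmetric under permutations of the coordinates. For a probability measure $\nu$ on $X^N$ put $E^{(N)}(\nu)=\frac1N\int_{X^N}H^{(N)}\,d\nu$, and let $\delta_N:X^N\to\mathcal P(X)$, $\delta_N(x_1,\dots,x_N)=\frac1N\sum_{i=1}^N\delta_{x_i}$. For $\mu\in\mathcal P(X)$ let $D_{\mu_0}(\mu)=\int\log\frac{d\mu}{d\mu_0}\,d\mu$ if $\mu\ll\mu_0$ and $D_{\mu_0}(\mu)=\infty$ otherwise. Let $E:\mathcal P(X)\to(-\infty,\infty]$ be a functional, and consider the following hypotheses. * (H1) For every $\mu\in\mathcal P(X)$ with $E(\mu)<\infty$ one has $\lim_{N\to\infty}E^{(N)}(\mu^{\otimes N})=E(\mu)$; moreover $E(\mu_0)<\infty$. * (H2) For every sequence of symmetric probability measures $\mu^{(N)}$ on $X^N$ such that $(\delta_N)_*\mu^{(N)}$ converges weakly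 to some $\Gamma\in\mathcal P(\mathcal P(X))$, one has $\liminf_{N\to\infty}E^{(N)}(\mu^{(N)})\ge\int_{\mathcal P(X)}E(\mu)\,d\Gamma(\mu)$. * (H3) For every $\mu\in\mathcal P(X)$ with $E(\mu)<\infty$ there is a sequence $\mu_j\to\mu$ weakly such that each $\mu_j$ is absolutely continuous with respect to $\mu_0$ with $D_{\mu_0}(\mu_j)<\infty$, and $E(\mu_j)\to E(\mu)$. Measures $\Gamma_N$ on $\mathcal P(X)$ (not necessarily normalized) satisfy a large deviation principle (LDP) with speed $r_N$ and rate functional $I$ if $I:\mathcal P(X)\to(-\infty,\infty]$ is lower semicontinuous, $\limsup_{N\to\infty}\frac1{r_N}\log\Gamma_N(\mathcal F)\le-\inf_{\mathcal F}I$ for every closed $\mathcal F$, and $\liminf_{N\to\infty}\frac1{r_N}\log\Gamma_N(\mathcal G)\ge-\inf_{\mathcal G}I$ for every open $\mathcal G$. **Theorem.** Assume (H1) and (H2), let $\beta_N>0$ with $\beta_N\to\beta\in(0,\infty]$, and if $\beta=\infty$ assume (H3) as well. Then the measures $(\delta_N)_*\bigl(e^{-\beta_NH^{(N)}}\mu_0^{\otimes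 N}\bigr)$ satisfy an LDP with speed $\beta_NN$ and rate functional $F_\beta=E+\frac1\beta D_{\mu_0}$, where $F_\infty=E$. Equivalently, the laws $(\delta_N)_*\bigl(Z_N^{-1}e^{-\beta_NH^{(N)}}\mu_0^{\otimes N}\bigr)$ of the empirical measure under the Gibbs measures, where $Z_N=\int_{X^N}e^{-\beta_NH^{(N)}}\,d\mu_0^{\otimes N}$, satisfy an LDP with speed $\beta_NN$ and rate functional $F_\beta-\inf_{\mathcal P(X)}F_\beta$. Both LDPs hold. -/

import Mathlib

open MeasureTheory Filter Topology InformationTheory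
open scoped ENNReal NNReal

namespace GibbsLDP

section GiryBorel

variable {X : Type*} [TopologicalSpace X] [CompactSpace X] [TopologicalSpace.MetrizableSpace X]
  [MeasurableSpace X] [BorelSpace X]

/-- On `P(X)`, `X` compact metrizable, the σ-algebra that Mathlib puts on `ProbabilityMeasure X`
(generated by the evaluations `μ ↦ μ A`) is the Borel σ-algebra of the weak topology. -/
instance borelSpace_probabilityMeasure : BorelSpace (ProbabilityMeasure X) := by
  refine ⟨le_antisymm ?_ ?_⟩
  · -- evaluations are Borel
    suffices hm : ∀ s : Set X, MeasurableSet s →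
        @Measurable _ _ (borel (ProbabilityMeasure X)) _
          fun μ : ProbabilityMeasure X => (μ : Measure X) s by
      have hval : @Measurable _ _ (borel (ProbabilityMeasure X)) _
          fun μ : ProbabilityMeasure X => (μ : Measure X) :=
        @Measure.measurable_of_measurable_coe _ _ _ (borel _) _ hm
      rintro s ⟨t, ht, rfl⟩
      exact hval ht
    let mY : MeasurableSpace (ProbabilityMeasure X) := borel _
    have bY : BorelSpace (ProbabilityMeasure X) := ⟨rfl⟩
    have hopen : ∀ s : Set X, IsOpen s →
        Measurable fun μ : ProbabilityMeasure X => (μ : Measure X) s := by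
      intro s hs
      refine LowerSemicontinuous.measurable (lowerSemicontinuous_iff_le_liminf.2 fun μ => ?_)
      exact ProbabilityMeasure.le_liminf_measure_open_of_tendsto tendsto_id hs
    intro s hs
    induction s, hs using MeasurableSpace.induction_on_inter
      (BorelSpace.measurable_eq (α := X)) isPiSystem_isOpen with
    | empty => simp
    | basic t ht => exact hopen t ht
    | compl t ht ih =>
      have : (fun μ : ProbabilityMeasure X => (μ : Measure X) tᶜ)
          = fun μ : ProbabilityMeasure X => 1 - (μ : Measure X) t := by
        funext μ
        rw [prob_compl_eq_one_sub ht]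
      exact this ▸ (measurable_const.sub ih)
    | iUnion f hd hm ih =>
      have : (fun μ : ProbabilityMeasure X => (μ : Measure X) (⋃ i, f i))
          = fun μ : ProbabilityMeasure X => ∑' i, (μ : Measure X) (f i) := by
        funext μ
        exact measure_iUnion hd hm
      exact this ▸ Measurable.tsum ih
  · -- open sets are in the σ-algebra generated by the evaluations
    have hnhds : ∀ μ : ProbabilityMeasure X, 𝓝 μ =
        ⨅ f : BoundedContinuousFunction X ℝ≥0, comap
          (fun μ : ProbabilityMeasure X => ∫⁻ x, (f x : ℝ≥0∞) ∂(μ : Measure X))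
          (𝓝 (∫⁻ x, (f x : ℝ≥0∞) ∂(μ : Measure X))) := by
      intro μ
      refine le_antisymm (le_iInf fun f => ?_) ?_
      · rw [← tendsto_iff_comap]
        exact ProbabilityMeasure.tendsto_iff_forall_lintegral_tendsto.1
          (tendsto_id (x := 𝓝 μ)) f
      · rw [← tendsto_id', ProbabilityMeasure.tendsto_iff_forall_lintegral_tendsto]
        intro f
        rw [tendsto_iff_comap]
        exact iInf_le _ f
    have hsub : (ProbabilityMeasure.instTopologicalSpace :
        TopologicalSpace (ProbabilityMeasure X)) =
        TopologicalSpace.generateFrom (⋃ f : BoundedContinuousFunction X ℝ≥0,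
          {s | IsOpen[TopologicalSpace.induced
          (fun μ : ProbabilityMeasure X => ∫⁻ x, (f x : ℝ≥0∞) ∂(μ : Measure X)) inferInstance] s}) := by
      refine (TopologicalSpace.ext_nhds fun μ => ?_).trans (generateFrom_iUnion_isOpen
        fun f : BoundedContinuousFunction X ℝ≥0 => TopologicalSpace.induced
          (fun μ : ProbabilityMeasure X => ∫⁻ x, (f x : ℝ≥0∞) ∂(μ : Measure X))
          inferInstance).symm
      rw [nhds_iInf]
      exact (hnhds μ).trans (iInf_congr fun f => (nhds_induced _ _).symm)
    rw [borel_eq_generateFrom_of_subbasis hsub]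
    refine MeasurableSpace.generateFrom_le ?_
    intro s hs
    obtain ⟨f, hf⟩ := Set.mem_iUnion.1 hs
    obtain ⟨u, hu, rfl⟩ := isOpen_induced_iff.1 hf
    have : Measurable fun μ : ProbabilityMeasure X => ∫⁻ x, (f x : ℝ≥0∞) ∂(μ : Measure X) :=
      (Measure.measurable_lintegral
        (ENNReal.continuous_coe.comp f.continuous).measurable).comp measurable_subtype_coe
    exact this hu.measurableSet

end GiryBorel

/-- The integral of an extended-real function: integral of the positive part minus integral of the
negative part (the value is `⊥` if both are infinite). -/
noncomputable def eintegral {α : Type*} [MeasurableSpace α] (f : α → EReal) (μ : Measure α) :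
    EReal :=
  ((∫⁻ x, (f x).toENNReal ∂μ : ℝ≥0∞) : EReal) - ((∫⁻ x, (-f x).toENNReal ∂μ : ℝ≥0∞) : EReal)

section LDP

variable {Y : Type*} [TopologicalSpace Y] [MeasurableSpace Y]

/-- A rate function: lower semicontinuous with values in `]-∞, ∞]`. -/
structure IsRateFunction (I : Y → EReal) : Prop where
  lsc : LowerSemicontinuous I
  ne_bot : ∀ y, I y ≠ ⊥

/-- The measures `Γ N` (not necessarily normalized) satisfy a large deviation principle
with speed `r N` and rate function `I`. -/
structure SatisfiesLDP (Γ : ℕ+ → Measure Y) (r : ℕ+ → ℝ) (I : Y → EReal) : Prop where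
  rate : IsRateFunction I
  upper : ∀ C : Set Y, IsClosed C →
    limsup (fun N => ENNReal.log (Γ N C) / (r N : EReal)) atTop ≤ -(⨅ y ∈ C, I y)
  lower : ∀ G : Set Y, IsOpen G →
    -(⨅ y ∈ G, I y) ≤ liminf (fun N => ENNReal.log (Γ N G) / (r N : EReal)) atTop

end LDP

section Empirical

variable {X : Type*} [MeasurableSpace X]

/-- The empirical measure `δ_N(x₁, …, x_N) = (1/N) ∑ δ_{x_i}`. -/
noncomputable def empirical (N : ℕ+) (x : Fin (N : ℕ) → X) : ProbabilityMeasure X :=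
  ⟨((N : ℕ) : ℝ≥0∞)⁻¹ • ∑ i, Measure.dirac (x i), ⟨by
    simp [ENNReal.inv_mul_cancel (Nat.cast_ne_zero.2 N.ne_zero) (ENNReal.natCast_ne_top _)]⟩⟩

theorem measurable_empirical (N : ℕ+) :
    Measurable (empirical N : (Fin (N : ℕ) → X) → ProbabilityMeasure X) := by
  refine Measurable.subtype_mk (Measure.measurable_of_measurable_coe _ fun s hs => ?_)
  simp only [Measure.smul_apply, Measure.finsetSum_apply, smul_eq_mul]
  refine Measurable.const_mul (Finset.measurable_sum _ fun i _ => ?_) _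
  exact (Measure.measurable_coe hs).comp (Measure.measurable_dirac.comp (measurable_pi_apply i))

/-- Invariance of a measure on `X^N` under permutations of the coordinates. -/
def IsSymmetric {N : ℕ} (ν : Measure (Fin N → X)) : Prop :=
  ∀ σ : Equiv.Perm (Fin N), ν.map (fun x => x ∘ σ) = ν

/-- The mean energy `E^{(N)}(ν) = (1/N) ∫ H^{(N)} dν`. -/
noncomputable def meanEnergy (N : ℕ+) (HN : (Fin (N : ℕ) → X) → EReal)
    (ν : Measure (Fin (N : ℕ) → X)) : EReal :=
  eintegral HN ν / ((N : ℕ) : EReal)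

/-- The measure `e^{-β H} μ₀^{⊗N}` on `X^N` (with `e^{-∞} = 0`). -/
noncomputable def boltzmann (N : ℕ+) (b : ℝ) (HN : (Fin (N : ℕ) → X) → EReal)
    (μ₀ : ProbabilityMeasure X) : Measure (Fin (N : ℕ) → X) :=
  (Measure.pi fun _ => (μ₀ : Measure X)).withDensity fun x => EReal.exp (-((b : EReal) * HN x))

/-- The partition function `Z = ∫ e^{-β H} dμ₀^{⊗N}`. -/
noncomputable def partitionFunction (N : ℕ+) (b : ℝ) (HN : (Fin (N : ℕ) → X) → EReal)
    (μ₀ : ProbabilityMeasure X) : ℝ≥0∞ :=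
  ∫⁻ x, EReal.exp (-((b : EReal) * HN x)) ∂(Measure.pi fun _ => (μ₀ : Measure X))

/-- The Gibbs measure `e^{-β H} μ₀^{⊗N} / Z`. -/
noncomputable def gibbs (N : ℕ+) (b : ℝ) (HN : (Fin (N : ℕ) → X) → EReal)
    (μ₀ : ProbabilityMeasure X) : Measure (Fin (N : ℕ) → X) :=
  (partitionFunction N b HN μ₀)⁻¹ • boltzmann N b HN μ₀

/-- The free energy `F_β = E + D_{μ₀} / β`, with `F_∞ = E`. The relative entropy `D_{μ₀}(μ)` is
Mathlib's `klDiv μ μ₀`, which is `∞` unless `μ ≪ μ₀`. -/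
noncomputable def freeEnergy (μ₀ : ProbabilityMeasure X) (E : ProbabilityMeasure X → EReal)
    (β : EReal) (μ : ProbabilityMeasure X) : EReal :=
  E μ + if β = ⊤ then 0 else ((klDiv (μ : Measure X) (μ₀ : Measure X) : ℝ≥0∞) : EReal) / β

/-- Existence of the macroscopic mean energy: `E^{(N)}(μ^{⊗N}) → E(μ)` whenever `E(μ) < ∞`,
and `E(μ₀) < ∞`. -/
def HypH1 (H : (N : ℕ+) → (Fin (N : ℕ) → X) → EReal) (μ₀ : ProbabilityMeasure X)
    (E : ProbabilityMeasure X → EReal) : Prop :=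
  (∀ μ : ProbabilityMeasure X, E μ < ⊤ →
    Tendsto (fun N : ℕ+ => meanEnergy N (H N) (Measure.pi fun _ => (μ : Measure X))) atTop
      (𝓝 (E μ))) ∧
  E μ₀ < ⊤

end Empirical

section Hypotheses

variable {X : Type*} [TopologicalSpace X] [CompactSpace X] [TopologicalSpace.MetrizableSpace X]
  [MeasurableSpace X] [BorelSpace X]

/-- Lower bound on the mean energy: if `ν_N` are symmetric probability measures on `X^N` and
`(δ_N)_* ν_N → Γ` weakly in `P(P(X))`, then `liminf E^{(N)}(ν_N) ≥ ∫ E dΓ`. -/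
def HypH2 (H : (N : ℕ+) → (Fin (N : ℕ) → X) → EReal) (E : ProbabilityMeasure X → EReal) : Prop :=
  ∀ ν : (N : ℕ+) → ProbabilityMeasure (Fin (N : ℕ) → X),
    (∀ N : ℕ+, IsSymmetric (ν N : Measure (Fin (N : ℕ) → X))) →
    ∀ Γ : ProbabilityMeasure (ProbabilityMeasure X),
      Tendsto (fun N => (ν N).map (measurable_empirical N).aemeasurable) atTop (𝓝 Γ) →
      eintegral E (Γ : Measure (ProbabilityMeasure X)) ≤
        liminf (fun N => meanEnergy N (H N) (ν N : Measure (Fin (N : ℕ) → X))) atTop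

/-- Approximation property: every `μ` with `E(μ) < ∞` is a weak limit of measures `m j`,
absolutely continuous with respect to `μ₀` and of finite relative entropy, with
`E(m j) → E(μ)`. -/
def HypH3 (μ₀ : ProbabilityMeasure X) (E : ProbabilityMeasure X → EReal) : Prop :=
  ∀ μ : ProbabilityMeasure X, E μ < ⊤ →
    ∃ m : ℕ → ProbabilityMeasure X, Tendsto m atTop (𝓝 μ) ∧
      (∀ j, (m j : Measure X) ≪ (μ₀ : Measure X) ∧
        klDiv (m j : Measure X) (μ₀ : Measure X) < ⊤) ∧
      Tendsto (fun j => E (m j)) atTop (𝓝 (E μ))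

end Hypotheses

end GibbsLDP

/-!
Under the reference product measure, the empirical measure of `N` points is near `μ` with
probability about `exp (-N D(μ | μ₀))` (Sanov), and on such configurations the Hamiltonian is about
`N E μ`. So the Boltzmann mass of a small neighbourhood of `μ` is about
`exp (-β_N N (E μ + D(μ | μ₀) / β_N))`, and as `P(X)` is compact, such local estimates already give
the large deviation principle: `LocalUpper` and `LocalLower` are the two halves, and
`satisfiesLDP_of_local` assembles them. Lower semicontinuity of the rate function is a consequence of
these estimates, and dividing by the total mass only shifts the rate by its infimum
(`satisfiesLDP_normalized_of_local`).

*Upper half* (`localUpper_boltzmann`). Hypothesis `HypH2` is only needed for `Γ` a Dirac mass: tested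
on symmetrized Dirac masses at configurations, it says that `H ≥ N a` pointwise on all
configurations with empirical measure close to `μ`, for every `a < E μ` (`HypH2.exists_open_le`).
The entropic factor comes from Chernoff's inequality with a continuous test function that almost
attains the Donsker–Varadhan supremum (`exists_continuous_of_lt_klDiv`,
`exists_open_pi_empirical_le`).

*Lower half* (`localLower_boltzmann`). Take `μ` of finite energy and entropy, and look at `μ^{⊗N}`.
By the law of large numbers the empirical measure is close to `μ` and the log-likelihood ratio is
close to `N D(μ | μ₀)` with high probability. The energy is almost bounded below by `N E μ` by the
pointwise bound, and its mean is asymptotically `N E μ` by `HypH1`, so Markov's inequality bounds it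
above with probability bounded below (`eventually_pi_energy_gt_le`). A change of measure on the
intersection of these events gives the bound (`eventually_le_boltzmann`). For `β = ∞` the entropy
is negligible, and `HypH3` reduces to measures where it is finite.
-/

namespace GibbsLDP

/-! ### Large deviation principles from local estimates -/

section AbstractLDP

variable {Y : Type*} [TopologicalSpace Y] [MeasurableSpace Y]

/-- Local form of the large deviation upper bound: `Γ N U ≤ exp (-r N a)` eventually, for a small
enough open neighbourhood `U` of `y`, whenever `a < I y`. -/
def LocalUpper (Γ : ℕ+ → Measure Y) (r : ℕ+ → ℝ) (I : Y → EReal) : Prop :=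
  ∀ (y : Y) (a : ℝ), (a : EReal) < I y → ∃ U : Set Y, IsOpen U ∧ y ∈ U ∧
    ∀ᶠ N in atTop, Γ N U ≤ ENNReal.ofReal (Real.exp (-(r N * a)))

/-- Local form of the large deviation lower bound: `exp (-r N a) ≤ Γ N G` eventually, for every
open neighbourhood `G` of `y`, whenever `I y < a`. -/
def LocalLower (Γ : ℕ+ → Measure Y) (r : ℕ+ → ℝ) (I : Y → EReal) : Prop :=
  ∀ (y : Y) (a : ℝ), I y < (a : EReal) → ∀ G : Set Y, IsOpen G → y ∈ G →
    ∀ᶠ N in atTop, ENNReal.ofReal (Real.exp (-(r N * a))) ≤ Γ N G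

theorem log_div_le_of_le_exp {m : ℝ≥0∞} {r a : ℝ} (hr : 0 < r)
    (h : m ≤ ENNReal.ofReal (Real.exp (-(r * a)))) :
    ENNReal.log m / (r : EReal) ≤ ((-a : ℝ) : EReal) := by
  rw [EReal.div_le_iff_le_mul (by exact_mod_cast hr) (EReal.coe_ne_top r), ← EReal.coe_mul]
  refine (ENNReal.log_monotone h).trans (le_of_eq ?_)
  rw [ENNReal.log_ofReal_of_pos (Real.exp_pos _), Real.log_exp]
  congr 1
  ring

theorem le_log_div_of_exp_le {m : ℝ≥0∞} {r a : ℝ} (hr : 0 < r)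
    (h : ENNReal.ofReal (Real.exp (-(r * a))) ≤ m) :
    ((-a : ℝ) : EReal) ≤ ENNReal.log m / (r : EReal) := by
  rw [EReal.le_div_iff_mul_le (by exact_mod_cast hr) (EReal.coe_ne_top r), ← EReal.coe_mul]
  refine le_trans (le_of_eq ?_) (ENNReal.log_monotone h)
  rw [ENNReal.log_ofReal_of_pos (Real.exp_pos _), Real.log_exp]
  congr 1
  ring

variable {Γ : ℕ+ → Measure Y} {r : ℕ+ → ℝ} {I : Y → EReal}

/-- By compactness, the local upper bound extends to closed sets. -/
theorem LocalUpper.eventually_le [CompactSpace Y] (hU : LocalUpper Γ r I)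
    (hr : Tendsto r atTop atTop) {C : Set Y} (hC : IsClosed C) {a b : ℝ} (hab : a < b)
    (hb : ∀ y ∈ C, (b : EReal) < I y) :
    ∀ᶠ N in atTop, Γ N C ≤ ENNReal.ofReal (Real.exp (-(r N * a))) := by
  have key : ∃ k : ℕ, ∀ᶠ N in atTop, Γ N C ≤ k * ENNReal.ofReal (Real.exp (-(r N * b))) := by
    refine hC.isCompact.induction_on (p := fun s => ∃ k : ℕ, ∀ᶠ N in atTop,
      Γ N s ≤ k * ENNReal.ofReal (Real.exp (-(r N * b)))) ⟨0, by simp⟩ ?_ ?_ ?_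
    · rintro s t hst ⟨k, hk⟩
      exact ⟨k, hk.mono fun N h => (measure_mono hst).trans h⟩
    · rintro s t ⟨k, hk⟩ ⟨l, hl⟩
      refine ⟨k + l, ?_⟩
      filter_upwards [hk, hl] with N h1 h2
      refine (measure_union_le s t).trans ((add_le_add h1 h2).trans (le_of_eq ?_))
      push_cast
      ring
    · intro y hy
      obtain ⟨U, hUo, hyU, hle⟩ := hU y b (hb y hy)
      exact ⟨U, mem_nhdsWithin_of_mem_nhds (hUo.mem_nhds hyU), 1, by simpa using hle⟩
  obtain ⟨k, hk⟩ := key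
  filter_upwards [hk, hr.eventually_ge_atTop (k / (b - a))] with N h1 h2
  refine h1.trans ?_
  rw [← ENNReal.ofReal_natCast, ← ENNReal.ofReal_mul (Nat.cast_nonneg k)]
  refine ENNReal.ofReal_le_ofReal ?_
  have h3 : (k : ℝ) ≤ Real.exp (r N * (b - a)) := by
    have := (div_le_iff₀ (sub_pos.2 hab)).1 h2
    linarith [Real.add_one_le_exp (r N * (b - a))]
  calc (k : ℝ) * Real.exp (-(r N * b))
      ≤ Real.exp (r N * (b - a)) * Real.exp (-(r N * b)) := by gcongr
    _ = Real.exp (-(r N * a)) := by rw [← Real.exp_add]; congr 1; ring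

/-- Lower semicontinuity comes for free: on a neighbourhood where the upper bound holds with
exponent `a`, the lower bound forces `a ≤ I`. -/
theorem lowerSemicontinuous_of_local (hU : LocalUpper Γ r I) (hL : LocalLower Γ r I)
    (hr : Tendsto r atTop atTop) : LowerSemicontinuous I := by
  intro y c hc
  obtain ⟨b, hcb, hby⟩ := EReal.lt_iff_exists_real_btwn.1 hc
  obtain ⟨U, hUo, hyU, hle⟩ := hU y b hby
  filter_upwards [hUo.mem_nhds hyU] with z hz
  refine hcb.trans_le (le_of_not_gt fun hlt => ?_)
  obtain ⟨d, hzd, hdb⟩ := EReal.lt_iff_exists_real_btwn.1 hlt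
  obtain ⟨N, h1, h2, h3⟩ := (hle.and ((hL z d hzd U hUo hz).and (hr.eventually_gt_atTop 0))).exists
  have h4 := (ENNReal.ofReal_le_ofReal_iff (Real.exp_pos _).le).1 (h2.trans h1)
  rw [Real.exp_le_exp] at h4
  have : d < b := by exact_mod_cast hdb
  nlinarith

theorem satisfiesLDP_of_local [CompactSpace Y] (hU : LocalUpper Γ r I) (hL : LocalLower Γ r I)
    (hr : Tendsto r atTop atTop) (hI : ∀ y, I y ≠ ⊥) : SatisfiesLDP Γ r I where
  rate := ⟨lowerSemicontinuous_of_local hU hL hr, hI⟩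
  upper C hC := by
    refine EReal.le_neg_of_le_neg (le_of_forall_lt fun c hc => ?_)
    obtain ⟨a, hca, ha⟩ := EReal.lt_iff_exists_real_btwn.1 hc
    obtain ⟨b, hab, hb⟩ := EReal.lt_iff_exists_real_btwn.1 ha
    refine hca.trans_le (EReal.le_neg_of_le_neg ?_)
    have hab' : a < b := by exact_mod_cast hab
    refine limsup_le_of_le (by isBoundedDefault) ?_
    filter_upwards [hU.eventually_le hr hC hab' fun y hy => hb.trans_le (iInf₂_le y hy),
      hr.eventually_gt_atTop 0] with N h1 h2
    exact log_div_le_of_le_exp h2 h1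
  lower G hG := by
    refine EReal.neg_le_of_neg_le (le_iInf₂ fun y hy => le_of_forall_gt fun c hc => ?_)
    obtain ⟨a, ha, hac⟩ := EReal.lt_iff_exists_real_btwn.1 hc
    refine lt_of_le_of_lt (EReal.neg_le_of_neg_le ?_) hac
    refine le_liminf_of_le (by isBoundedDefault) ?_
    filter_upwards [hL y a ha G hG hy, hr.eventually_gt_atTop 0] with N h1 h2
    exact le_log_div_of_exp_le h2 h1

/-- Normalizing by the total mass, which behaves like `exp (-r N inf I)`, subtracts `inf I` from
the rate function. -/
theorem satisfiesLDP_normalized_of_local [CompactSpace Y] [Nonempty Y] (hU : LocalUpper Γ r I)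
    (hL : LocalLower Γ r I) (hr : Tendsto r atTop atTop) (hI : ∀ y, I y ≠ ⊥)
    (hfin : ∃ y, I y < ⊤) :
    SatisfiesLDP (fun N => (Γ N Set.univ)⁻¹ • Γ N) r (fun y => I y - ⨅ z, I z) := by
  have hlsc := lowerSemicontinuous_of_local hU hL hr
  obtain ⟨y₀, -, hy₀⟩ := (hlsc.lowerSemicontinuousOn Set.univ).exists_isMinOn
    Set.univ_nonempty isCompact_univ
  have hinf : ⨅ z, I z = I y₀ :=
    le_antisymm (iInf_le _ _) (le_iInf fun z => hy₀ (Set.mem_univ z))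
  obtain ⟨m, hm⟩ : ∃ m : ℝ, I y₀ = m := by
    obtain ⟨y, hy⟩ := hfin
    have h1 : I y₀ ≤ I y := hy₀ (Set.mem_univ y)
    exact ⟨(I y₀).toReal, (EReal.coe_toReal (h1.trans_lt hy).ne (hI y₀)).symm⟩
  rw [hinf, hm]
  have hmle : ∀ z, (m : EReal) ≤ I z := fun z => hm ▸ hy₀ (Set.mem_univ z)
  -- two-sided bounds on the total mass
  have hZl : ∀ ε > 0, ∀ᶠ N in atTop,
      ENNReal.ofReal (Real.exp (-(r N * (m + ε)))) ≤ Γ N Set.univ := fun ε hε =>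
    hL y₀ (m + ε) (by rw [hm]; exact_mod_cast lt_add_of_pos_right m hε) _ isOpen_univ trivial
  have hZu : ∀ ε > 0, ∀ᶠ N in atTop,
      Γ N Set.univ ≤ ENNReal.ofReal (Real.exp (-(r N * (m - ε)))) := fun ε hε =>
    hU.eventually_le hr isClosed_univ (a := m - ε) (b := m - ε / 2) (by linarith) fun y _ =>
      lt_of_lt_of_le (by exact_mod_cast (by linarith : m - ε / 2 < m)) (hmle y)
  refine satisfiesLDP_of_local ?_ ?_ hr fun y => ?_
  · intro y a ha
    have ha' : ((a + m : ℝ) : EReal) < I y := by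
      rw [EReal.coe_add]
      exact EReal.add_lt_of_lt_sub ha
    obtain ⟨c, hc1, hc2⟩ := EReal.lt_iff_exists_real_btwn.1 ha'
    have hc1' : a + m < c := by exact_mod_cast hc1
    obtain ⟨U, hUo, hyU, hle⟩ := hU y c hc2
    refine ⟨U, hUo, hyU, ?_⟩
    filter_upwards [hle, hZl (c - a - m) (by linarith)] with N h1 h2
    calc (Γ N Set.univ)⁻¹ * Γ N U
        ≤ (ENNReal.ofReal (Real.exp (-(r N * (m + (c - a - m))))))⁻¹ *
          ENNReal.ofReal (Real.exp (-(r N * c))) :=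
          mul_le_mul' (ENNReal.inv_le_inv.2 h2) h1
      _ = ENNReal.ofReal (Real.exp (-(r N * a))) := by
        rw [← ENNReal.ofReal_inv_of_pos (Real.exp_pos _), ← Real.exp_neg,
          ← ENNReal.ofReal_mul (Real.exp_pos _).le, ← Real.exp_add]
        congr 2
        ring
  · intro y a ha G hG hy
    have ha' : I y < ((a + m : ℝ) : EReal) := by
      rw [EReal.coe_add]
      exact (EReal.sub_lt_iff (by simp) (by simp)).1 ha
    obtain ⟨c, hc1, hc2⟩ := EReal.lt_iff_exists_real_btwn.1 ha'
    have hc2' : c < a + m := by exact_mod_cast hc2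
    filter_upwards [hL y c hc1 G hG hy, hZu (m + a - c) (by linarith)] with N h1 h2
    calc ENNReal.ofReal (Real.exp (-(r N * a)))
        = (ENNReal.ofReal (Real.exp (-(r N * (m - (m + a - c))))))⁻¹ *
          ENNReal.ofReal (Real.exp (-(r N * c))) := by
          rw [← ENNReal.ofReal_inv_of_pos (Real.exp_pos _), ← Real.exp_neg,
            ← ENNReal.ofReal_mul (Real.exp_pos _).le, ← Real.exp_add]
          congr 2
          ring
      _ ≤ (Γ N Set.univ)⁻¹ * Γ N G := mul_le_mul' (ENNReal.inv_le_inv.2 h2) h1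
  · have h1 : ((0 : ℝ) : EReal) ≤ I y - m := by
      rw [EReal.le_sub_iff_add_le (by simp) (by simp)]
      simpa using hmle y
    exact ne_bot_of_le_ne_bot (EReal.coe_ne_bot 0) h1

end AbstractLDP

/-! ### Product measures and the law of large numbers -/

section Product

variable {X : Type*} [MeasurableSpace X]

theorem integral_empirical (N : ℕ+) (x : Fin (N : ℕ) → X) (f : X → ℝ) (hf : Measurable f) :
    ∫ y, f y ∂(empirical N x : Measure X) = (∑ i, f (x i)) / (N : ℕ) := by
  have : (empirical N x : Measure X) =
      ((N : ℕ) : ℝ≥0∞)⁻¹ • ∑ i, Measure.dirac (x i) := rfl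
  rw [this, integral_smul_measure, integral_finsetSum_measure]
  · simp only [integral_dirac' _ _ hf.stronglyMeasurable, smul_eq_mul, ENNReal.toReal_inv,
      ENNReal.toReal_natCast]
    rw [div_eq_inv_mul]
  · intro i _
    exact (integrable_dirac' hf.stronglyMeasurable (by simp))

/-- Empirical measures do not see the order of the points. -/
theorem empirical_comp_perm (N : ℕ+) (x : Fin (N : ℕ) → X) (σ : Equiv.Perm (Fin (N : ℕ))) :
    empirical N (x ∘ σ) = empirical N x := by
  refine Subtype.ext ?_
  change ((N : ℕ) : ℝ≥0∞)⁻¹ • ∑ i, Measure.dirac ((x ∘ σ) i) =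
    ((N : ℕ) : ℝ≥0∞)⁻¹ • ∑ i, Measure.dirac (x i)
  congr 1
  exact Equiv.sum_comp σ fun i => Measure.dirac (x i)

theorem lintegral_pi_prod {n : ℕ} (μ : Measure X) [IsProbabilityMeasure μ]
    (f : Fin n → X → ℝ≥0∞) (hf : ∀ i, Measurable (f i)) :
    ∫⁻ x, ∏ i, f i (x i) ∂(Measure.pi fun _ : Fin n => μ) = ∏ i, ∫⁻ y, f i y ∂μ := by
  rw [ProbabilityTheory.lintegral_prod_eq_prod_lintegral_of_indepFun Finset.univ
    (fun i (x : Fin n → X) => f i (x i))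
    (ProbabilityTheory.iIndepFun_pi fun i => (hf i).aemeasurable)
    fun i => (hf i).comp (measurable_pi_apply i)]
  exact Finset.prod_congr rfl fun i _ =>
    (measurePreserving_eval (fun _ : Fin n => μ) i).lintegral_comp (hf i)

theorem pi_withDensity {n : ℕ} (μ : Measure X) [IsProbabilityMeasure μ] (f : X → ℝ≥0∞)
    (hf : Measurable f) [IsProbabilityMeasure (μ.withDensity f)] :
    Measure.pi (fun _ : Fin n => μ.withDensity f) =
      (Measure.pi fun _ : Fin n => μ).withDensity fun x => ∏ i, f (x i) := by
  refine Measure.pi_eq fun s hs => ?_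
  rw [withDensity_apply _ (MeasurableSet.univ_pi hs),
    ← lintegral_indicator (MeasurableSet.univ_pi hs)]
  have h1 : (Set.univ.pi s).indicator (fun x : Fin n → X => ∏ i, f (x i)) =
      fun x => ∏ i, (s i).indicator f (x i) := by
    funext x
    by_cases hx : x ∈ Set.univ.pi s
    · rw [Set.indicator_of_mem hx]
      exact Finset.prod_congr rfl fun i _ => (Set.indicator_of_mem (hx i trivial) _).symm
    · rw [Set.indicator_of_notMem hx]
      obtain ⟨i, hi⟩ : ∃ i, x i ∉ s i := by simpa [Set.mem_pi] using hx
      exact (Finset.prod_eq_zero (Finset.mem_univ i) (Set.indicator_of_notMem hi _)).symm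
  rw [h1]
  rw [lintegral_pi_prod μ _ fun i => hf.indicator (hs i)]
  refine Finset.prod_congr rfl fun i _ => ?_
  rw [withDensity_apply _ (hs i), ← lintegral_indicator (hs i)]

/-- Weak law of large numbers, stated on the finite products. -/
theorem tendsto_pi_average (μ : Measure X) [IsProbabilityMeasure μ] {f : X → ℝ}
    (hfm : Measurable f) (hf : Integrable f μ) {ε : ℝ} (hε : 0 < ε) :
    Tendsto (fun N : ℕ+ => (Measure.pi fun _ : Fin (N : ℕ) => μ)
      {x | ε ≤ dist ((∑ i, f (x i)) / (N : ℕ)) (∫ y, f y ∂μ)}) atTop (𝓝 0) := by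
  set P : Measure (ℕ → X) := Measure.infinitePi fun _ => μ with hP
  have hind : ProbabilityTheory.iIndepFun (fun (i : ℕ) (ω : ℕ → X) => f (ω i)) P :=
    ProbabilityTheory.iIndepFun_infinitePi fun _ => hfm
  have hmp : ∀ i : ℕ, MeasurePreserving (fun ω : ℕ → X => ω i) P μ := fun i =>
    measurePreserving_eval_infinitePi _ i
  have hmeas : ∀ i : ℕ, Measurable fun ω : ℕ → X => f (ω i) := fun i =>
    hfm.comp (measurable_pi_apply i)
  have hlaw : ∀ i : ℕ, P.map (fun ω => f (ω i)) = μ.map f := fun i => by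
    rw [← (hmp i).map_eq, Measure.map_map hfm (measurable_pi_apply i)]
    rfl
  have hslln := ProbabilityTheory.strong_law_ae_real (fun (i : ℕ) (ω : ℕ → X) => f (ω i))
    ((hmp 0).integrable_comp_of_integrable hf) (fun i j hij => hind.indepFun hij)
    (fun i => ⟨(hmeas i).aemeasurable, (hmeas 0).aemeasurable, by rw [hlaw, hlaw]⟩)
  have hint : ∫ ω, f (ω 0) ∂P = ∫ y, f y ∂μ := by
    rw [← (hmp 0).map_eq]
    exact (integral_map (hmp 0).measurable.aemeasurable
      ((hmp 0).map_eq.symm ▸ hfm.aestronglyMeasurable)).symm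
  have hconv := tendstoInMeasure_iff_dist.1 (tendstoInMeasure_of_tendsto_ae
    (f := fun (n : ℕ) (ω : ℕ → X) => (∑ i ∈ Finset.range n, f (ω i)) / n)
    (g := fun _ => ∫ ω, f (ω 0) ∂P) (fun n =>
      ((Finset.measurable_sum _ fun i _ => hmeas i).div_const _).aestronglyMeasurable) hslln) ε hε
  have hcomp := hconv.comp tendsto_PNat_val_atTop_atTop
  refine hcomp.congr fun N => ?_
  -- the first `N` coordinates of the infinite product are distributed as the finite product
  have hmap : P.map (fun ω (i : Fin (N : ℕ)) => ω i) = Measure.pi fun _ : Fin (N : ℕ) => μ := by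
    have := Measure.map_infinitePi_infinitePi_of_inj (P := fun _ : ℕ => μ)
      (f := fun i : Fin (N : ℕ) => (i : ℕ)) Fin.val_injective
    rw [Measure.infinitePi_eq_pi (μ := fun _ : Fin (N : ℕ) => μ)] at this
    exact this
  have hms : MeasurableSet {x : Fin (N : ℕ) → X |
      ε ≤ dist ((∑ i, f (x i)) / (N : ℕ)) (∫ y, f y ∂μ)} := by
    have : Measurable fun x : Fin (N : ℕ) → X =>
        dist ((∑ i, f (x i)) / (N : ℕ)) (∫ y, f y ∂μ) :=
      ((Finset.measurable_sum _ fun i _ => hfm.comp (measurable_pi_apply i)).div_const _).dist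
        measurable_const
    exact measurableSet_le measurable_const this
  rw [← hmap, Measure.map_apply (measurable_pi_lambda _ fun i => measurable_pi_apply _) hms]
  simp only [Function.comp_apply, Set.preimage_ofPred_eq, hint, Finset.sum_range]

end Product

section WeakConvergence

variable {X : Type*} [TopologicalSpace X] [MeasurableSpace X] [BorelSpace X]

/-- The empirical measure of `N` independent points of law `μ` converges to `μ` in probability:
the sets `U` that `empirical N` leaves with vanishing probability form a filter, and by the law of
large numbers this filter is finer than `𝓝 μ`. -/
theorem tendsto_pi_empirical_compl (μ : ProbabilityMeasure X) {U : Set (ProbabilityMeasure X)}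
    (hU : U ∈ 𝓝 μ) :
    Tendsto (fun N : ℕ+ => (Measure.pi fun _ : Fin (N : ℕ) => (μ : Measure X))
      (empirical N ⁻¹' U)ᶜ) atTop (𝓝 0) := by
  let L : Filter (ProbabilityMeasure X) :=
    { sets := {V | Tendsto (fun N : ℕ+ => (Measure.pi fun _ : Fin (N : ℕ) => (μ : Measure X))
        (empirical N ⁻¹' V)ᶜ) atTop (𝓝 0)}
      univ_sets := by simp
      sets_of_superset := fun {V W} hV hVW =>
        tendsto_of_tendsto_of_tendsto_of_le_of_le tendsto_const_nhds hV (fun _ => zero_le)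
          fun N => measure_mono (Set.compl_subset_compl.2 (Set.preimage_mono hVW))
      inter_sets := fun {V W} hV hW => by
        have := Tendsto.add hV hW
        rw [add_zero] at this
        refine tendsto_of_tendsto_of_tendsto_of_le_of_le tendsto_const_nhds this
          (fun _ => zero_le) fun N => ?_
        simp only [Set.preimage_inter, Set.compl_inter]
        exact measure_union_le _ _ }
  suffices h : Tendsto (fun ν => ν) L (𝓝 μ) from h hU
  rw [ProbabilityMeasure.tendsto_iff_forall_integral_tendsto]
  intro f
  rw [Metric.tendsto_nhds]
  intro ε hε
  refine (tendsto_pi_average (μ : Measure X) f.continuous.measurable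
    (f.integrable _) hε).congr fun N => ?_
  congr 1
  ext x
  simp [integral_empirical N x f f.continuous.measurable]

end WeakConvergence

/-! ### The Donsker–Varadhan formula and the local Sanov upper bound -/

section DonskerVaradhan

/-- The truncation of `log x` to `[-n, n]`, written as the logarithm of a truncation so that
`log 0 = 0` does not interfere. -/
theorem truncLog_bounds (n x : ℝ) (hn : 0 ≤ n) :
    |Real.log (max (Real.exp (-n)) (min x (Real.exp n)))| ≤ n := by
  have h1 : 0 < max (Real.exp (-n)) (min x (Real.exp n)) := lt_max_of_lt_left (Real.exp_pos _)
  rw [abs_le]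
  constructor
  · rw [Real.le_log_iff_exp_le h1]
    exact le_max_left _ _
  · rw [Real.log_le_iff_le_exp h1]
    exact max_le (Real.exp_le_exp.2 (by linarith)) (min_le_right _ _)

theorem exp_truncLog_le {n x : ℝ} (hx : 0 ≤ x) :
    Real.exp (Real.log (max (Real.exp (-n)) (min x (Real.exp n)))) ≤ x + Real.exp (-n) := by
  rw [Real.exp_log (lt_max_of_lt_left (Real.exp_pos _))]
  exact max_le (by linarith) ((min_le_left _ _).trans (by linarith [Real.exp_pos (-n)]))

/-- The integrand `klFun x = x log x + 1 - x` stays nonnegative when the logarithm is truncated. -/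
theorem truncLog_klFun_nonneg {n x : ℝ} (hn : 1 ≤ n) (hx : 0 ≤ x) :
    0 ≤ x * Real.log (max (Real.exp (-n)) (min x (Real.exp n))) + 1 - x := by
  rcases le_total x (Real.exp (-n)) with h | h
  · have h2 : min x (Real.exp n) ≤ Real.exp (-n) := (min_le_left _ _).trans h
    rw [max_eq_left h2, Real.log_exp]
    have h3 : (n + 1) * Real.exp (-n) ≤ 1 := by
      calc (n + 1) * Real.exp (-n) ≤ Real.exp n * Real.exp (-n) := by
            gcongr; exact Real.add_one_le_exp n
        _ = 1 := by rw [← Real.exp_add]; simp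
    nlinarith
  · rcases le_total x (Real.exp n) with h' | h'
    · rw [min_eq_left h', max_eq_right h]
      exact klFun_nonneg hx
    · rw [min_eq_right h', max_eq_right (Real.exp_le_exp.2 (by linarith)), Real.log_exp]
      nlinarith

variable {X : Type*} [MeasurableSpace X]

/-- Donsker–Varadhan with bounded measurable test functions. If `μ ≪ μ₀` with density `ρ`, the
test functions are the truncations of `log ρ` to `[-n, n]`; Fatou's lemma for
`klFun ρ = ρ log ρ + 1 - ρ ≥ 0` treats finite and infinite divergence alike. -/
theorem exists_measurable_of_lt_klDiv (μ μ₀ : Measure X) [IsProbabilityMeasure μ]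
    [IsProbabilityMeasure μ₀] {a : ℝ} (ha : (a : EReal) < (klDiv μ μ₀ : ℝ≥0∞)) :
    ∃ (f : X → ℝ) (M : ℝ), Measurable f ∧ (∀ x, |f x| ≤ M) ∧
      a < ∫ x, f x ∂μ - Real.log (∫ x, Real.exp (f x) ∂μ₀) := by
  by_cases hac : μ ≪ μ₀
  swap
  -- without absolute continuity, large multiples of the indicator of a `μ₀`-null set do
  · obtain ⟨A, hA, h0, h1⟩ : ∃ A, MeasurableSet A ∧ μ₀ A = 0 ∧ μ A ≠ 0 := by
      by_contra! h
      exact hac (Measure.AbsolutelyContinuous.mk h)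
    have hpos : 0 < μ.real A := by
      rw [measureReal_def]
      exact ENNReal.toReal_pos h1 (measure_ne_top _ _)
    obtain ⟨n, hn⟩ := exists_nat_gt (a / μ.real A)
    refine ⟨A.indicator fun _ => (n : ℝ), n, measurable_const.indicator hA, fun x => ?_, ?_⟩
    · by_cases hx : x ∈ A <;> simp [hx]
    · have h2 : ∫ x, Real.exp (A.indicator (fun _ => (n : ℝ)) x) ∂μ₀ = ∫ _, (1 : ℝ) ∂μ₀ := by
        refine integral_congr_ae ?_
        filter_upwards [measure_eq_zero_iff_ae_notMem.1 h0] with x hx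
        simp [hx]
      rw [h2, integral_indicator_const _ hA]
      simp only [integral_const, probReal_univ, smul_eq_mul, mul_one, Real.log_one, sub_zero]
      rw [mul_comm]
      exact (div_lt_iff₀ hpos).1 hn
  set ρ : X → ℝ := fun x => (μ.rnDeriv μ₀ x).toReal with hρ
  have hρm : Measurable ρ := (Measure.measurable_rnDeriv μ μ₀).ennreal_toReal
  have hρ0 : ∀ x, 0 ≤ ρ x := fun x => ENNReal.toReal_nonneg
  have hρi : Integrable ρ μ₀ := Measure.integrable_toReal_rnDeriv
  have hρ1 : ∫ x, ρ x ∂μ₀ = 1 := by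
    rw [hρ, Measure.integral_toReal_rnDeriv hac]; simp
  set φ : ℕ → X → ℝ := fun n x =>
    Real.log (max (Real.exp (-n)) (min (ρ x) (Real.exp n))) with hφ
  have hφm : ∀ n, Measurable (φ n) := fun n =>
    Real.measurable_log.comp (measurable_const.max (hρm.min measurable_const))
  have hφb : ∀ n x, |φ n x| ≤ n := fun n x => truncLog_bounds n (ρ x) n.cast_nonneg
  have hφi : ∀ n, Integrable (fun x => ρ x * φ n x) μ₀ := fun n =>
    hρi.mul_bdd (c := n) (hφm n).aestronglyMeasurable (ae_of_all _ fun x => hφb n x)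
  have hφi1 : ∀ n, Integrable (fun x => ρ x * φ n x + 1) μ₀ := fun n =>
    (hφi n).add (integrable_const _)
  have hφi2 : ∀ n, Integrable (fun x => ρ x * φ n x + 1 - ρ x) μ₀ := fun n => (hφi1 n).sub hρi
  have hui : ∀ n, ∫ x, (ρ x * φ n x + 1 - ρ x) ∂μ₀ = ∫ x, φ n x ∂μ := fun n => by
    rw [integral_sub (hφi1 n) hρi,
      integral_add (hφi n) (integrable_const _), hρ1, ← integral_rnDeriv_smul hac]
    simp [hρ]
  have hlim : ∀ x, Tendsto (fun n : ℕ => ENNReal.ofReal (ρ x * φ n x + 1 - ρ x)) atTop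
      (𝓝 (ENNReal.ofReal (klFun (ρ x)))) := by
    intro x
    refine ENNReal.tendsto_ofReal (tendsto_const_nhds.congr' ?_)
    -- where `ρ = 0` the logarithm is a junk value, but it is multiplied by `ρ`
    rcases (hρ0 x).eq_or_lt with h | h
    · exact Eventually.of_forall fun n => by simp [← h, klFun]
    · obtain ⟨m, hm⟩ := exists_nat_ge |Real.log (ρ x)|
      filter_upwards [eventually_ge_atTop m] with n hn
      have hn' : |Real.log (ρ x)| ≤ n := hm.trans (by exact_mod_cast hn)
      rw [abs_le] at hn'
      have h1 : Real.exp (-n) ≤ ρ x := (Real.le_log_iff_exp_le h).1 hn'.1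
      have h2 : ρ x ≤ Real.exp n := (Real.log_le_iff_le_exp h).1 hn'.2
      simp only [hφ, min_eq_left h2, max_eq_right h1, klFun]
  have hfatou : klDiv μ μ₀ ≤ liminf (fun n => ENNReal.ofReal (∫ x, φ n x ∂μ)) atTop := by
    rw [klDiv_eq_lintegral_klFun_of_ac hac]
    calc ∫⁻ x, ENNReal.ofReal (klFun (ρ x)) ∂μ₀
        = ∫⁻ x, liminf (fun n => ENNReal.ofReal (ρ x * φ n x + 1 - ρ x)) atTop ∂μ₀ :=
          lintegral_congr fun x => (hlim x).liminf_eq.symm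
      _ ≤ liminf (fun n => ∫⁻ x, ENNReal.ofReal (ρ x * φ n x + 1 - ρ x) ∂μ₀) atTop :=
          lintegral_liminf_le fun n =>
            (((hρm.mul (hφm n)).add_const 1).sub hρm).ennreal_ofReal
      _ = liminf (fun n => ENNReal.ofReal (∫ x, φ n x ∂μ)) atTop := by
          refine liminf_congr ?_
          filter_upwards [eventually_ge_atTop 1] with n hn
          rw [← hui, ofReal_integral_eq_lintegral_ofReal (hφi2 n)
            (ae_of_all _ fun x => truncLog_klFun_nonneg (by exact_mod_cast hn) (hρ0 x))]
  -- leave room for the error `exp (-n)` in the normalization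
  obtain ⟨b, hab, hb⟩ : ∃ b : ℝ, a < b ∧ (b < 0 ∨ ENNReal.ofReal b < klDiv μ μ₀) := by
    obtain ⟨b, h1, h2⟩ := EReal.lt_iff_exists_real_btwn.1 ha
    refine ⟨b, by exact_mod_cast h1, ?_⟩
    rcases lt_or_ge b 0 with h | h
    · exact Or.inl h
    · refine Or.inr ?_
      rw [← EReal.coe_ennreal_lt_coe_ennreal_iff, EReal.coe_ennreal_ofReal, max_eq_left h]
      exact h2
  -- negative levels are below the value `0` of the zero test function
  rcases hb with hb | hb
  · exact ⟨fun _ => 0, 0, measurable_const, by simp, by simpa using hab.trans hb⟩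
  have hexp : Tendsto (fun n : ℕ => Real.exp (-(n : ℝ))) atTop (𝓝 0) :=
    Real.tendsto_exp_neg_atTop_nhds_zero.comp tendsto_natCast_atTop_atTop
  obtain ⟨n, h1, h2⟩ := ((eventually_lt_of_lt_liminf (hb.trans_le hfatou)).and
    (hexp.eventually_lt_const (sub_pos.2 hab))).exists
  refine ⟨φ n, n, hφm n, hφb n, ?_⟩
  have h3 : b < ∫ x, φ n x ∂μ := lt_of_not_ge fun h => h1.not_ge (ENNReal.ofReal_le_ofReal h)
  have h5 : ∫ x, Real.exp (φ n x) ∂μ₀ ≤ 1 + Real.exp (-n) := by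
    calc ∫ x, Real.exp (φ n x) ∂μ₀ ≤ ∫ x, (ρ x + Real.exp (-n)) ∂μ₀ := by
          refine integral_mono_of_nonneg (ae_of_all _ fun x => (Real.exp_pos _).le)
            (hρi.add (integrable_const _)) (ae_of_all _ fun x => exp_truncLog_le (hρ0 x))
      _ = 1 + Real.exp (-n) := by
          rw [integral_add hρi (integrable_const _), hρ1]; simp
  have h6 : 0 < ∫ x, Real.exp (φ n x) ∂μ₀ := by
    refine integral_exp_pos (Integrable.of_bound (C := Real.exp n)
      ((hφm n).exp).aestronglyMeasurable (ae_of_all _ fun x => ?_))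
    rw [Real.norm_eq_abs, abs_of_pos (Real.exp_pos _), Real.exp_le_exp]
    exact (le_abs_self _).trans (hφb n x)
  have h7 := Real.log_le_sub_one_of_pos h6
  linarith

variable [TopologicalSpace X] [CompactSpace X] [TopologicalSpace.MetrizableSpace X] [BorelSpace X]

/-- Donsker–Varadhan with continuous test functions, by density in `L¹(μ + μ₀)`. -/
theorem exists_continuous_of_lt_klDiv (μ μ₀ : ProbabilityMeasure X) {a : ℝ}
    (ha : (a : EReal) < (klDiv (μ : Measure X) μ₀ : ℝ≥0∞)) :
    ∃ f : BoundedContinuousFunction X ℝ,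
      a < ∫ x, f x ∂(μ : Measure X) - Real.log (∫ x, Real.exp (f x) ∂(μ₀ : Measure X)) := by
  obtain ⟨f, M, hfm, hfM, haf⟩ := exists_measurable_of_lt_klDiv (μ : Measure X) μ₀ ha
  have hfi : ∀ ν : Measure X, IsFiniteMeasure ν → Integrable f ν := fun ν _ =>
    Integrable.of_bound hfm.aestronglyMeasurable M (ae_of_all _ fun x => hfM x)
  have hei : Integrable (fun x => Real.exp (f x)) (μ₀ : Measure X) := by
    refine Integrable.of_bound (C := Real.exp M) hfm.exp.aestronglyMeasurable
      (ae_of_all _ fun x => ?_)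
    rw [Real.norm_eq_abs, abs_of_pos (Real.exp_pos _), Real.exp_le_exp]
    exact (le_abs_self _).trans (hfM x)
  have hepos : 0 < ∫ x, Real.exp (f x) ∂(μ₀ : Measure X) := integral_exp_pos hei
  -- an `L¹` error `ε` costs at most `ε` in `∫ f dμ` and `exp M * ε` in `∫ exp f dμ₀`
  have hcont : ContinuousAt (fun ε : ℝ => ∫ x, f x ∂(μ : Measure X) - ε -
      Real.log (∫ x, Real.exp (f x) ∂(μ₀ : Measure X) + Real.exp M * ε)) 0 := by
    refine (continuousAt_const.sub continuousAt_id).sub (ContinuousAt.log ?_ ?_)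
    · fun_prop
    · simpa using hepos.ne'
  obtain ⟨ε, hε, hεpos⟩ : ∃ ε : ℝ, a < ∫ x, f x ∂(μ : Measure X) - ε -
      Real.log (∫ x, Real.exp (f x) ∂(μ₀ : Measure X) + Real.exp M * ε) ∧ 0 < ε := by
    have h1 : ∀ᶠ ε in 𝓝[>] (0 : ℝ), a < ∫ x, f x ∂(μ : Measure X) - ε -
        Real.log (∫ x, Real.exp (f x) ∂(μ₀ : Measure X) + Real.exp M * ε) :=
      (hcont.tendsto.mono_left nhdsWithin_le_nhds).eventually_const_lt (by simpa using haf)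
    exact (h1.and self_mem_nhdsWithin).exists
  obtain ⟨g, hg, -⟩ :=
    (hfi ((μ : Measure X) + μ₀) inferInstance).exists_boundedContinuous_integral_sub_le hεpos
  -- truncating `g` at `±M` does not increase its distance to `f`, and bounds `exp`
  let h : BoundedContinuousFunction X ℝ :=
    BoundedContinuousFunction.mkOfCompact ⟨fun x => max (-M) (min M (g x)), by fun_prop⟩
  have hh : ∀ x, h x = max (-M) (min M (g x)) := fun _ => rfl
  have hfh : ∀ x, |f x - h x| ≤ |f x - g x| := fun x => by
    have := abs_le.1 (hfM x)
    rw [hh]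
    have hf' : f x = max (-M) (min M (f x)) := by rw [min_eq_right this.2, max_eq_right this.1]
    have h1 := abs_max_sub_max_le_max (-M) (min M (f x)) (-M) (min M (g x))
    have h2 := abs_min_sub_min_le_max M (f x) M (g x)
    simp only [sub_self, abs_zero, abs_nonneg, sup_of_le_right] at h1 h2
    rw [← hf'] at h1
    exact h1.trans h2
  have hdi : ∀ ν : Measure X, IsFiniteMeasure ν → Integrable (fun x => |f x - g x|) ν :=
    fun ν _ => ((hfi ν inferInstance).sub (g.integrable ν)).abs
  have hsum : ∫ x, |f x - g x| ∂(μ : Measure X) + ∫ x, |f x - g x| ∂(μ₀ : Measure X) ≤ ε := by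
    rw [← integral_add_measure (hdi _ inferInstance) (hdi _ inferInstance)]
    exact hg
  have hn1 : 0 ≤ ∫ x, |f x - g x| ∂(μ : Measure X) := integral_nonneg fun x => abs_nonneg _
  have hn2 : 0 ≤ ∫ x, |f x - g x| ∂(μ₀ : Measure X) := integral_nonneg fun x => abs_nonneg _
  refine ⟨h, hε.trans_le ?_⟩
  have k1 : ∫ x, f x ∂(μ : Measure X) - ε ≤ ∫ x, h x ∂(μ : Measure X) := by
    have : ∫ x, (f x - h x) ∂(μ : Measure X) ≤ ∫ x, |f x - g x| ∂(μ : Measure X) :=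
      integral_mono ((hfi _ inferInstance).sub (h.integrable _)) (hdi _ inferInstance) fun x =>
        (le_abs_self _).trans (hfh x)
    rw [integral_sub (hfi _ inferInstance) (h.integrable _)] at this
    linarith
  have hhi : Integrable (fun x => Real.exp (h x)) (μ₀ : Measure X) := by
    refine Integrable.of_bound (C := Real.exp ‖h‖) (Real.continuous_exp.comp
      h.continuous).aestronglyMeasurable (ae_of_all _ fun x => ?_)
    rw [Real.norm_eq_abs, abs_of_pos (Real.exp_pos _), Real.exp_le_exp]
    exact (le_abs_self _).trans (h.norm_coe_le_norm x)
  have k2 : ∫ x, Real.exp (h x) ∂(μ₀ : Measure X) ≤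
      ∫ x, Real.exp (f x) ∂(μ₀ : Measure X) + Real.exp M * ε := by
    calc ∫ x, Real.exp (h x) ∂(μ₀ : Measure X)
        ≤ ∫ x, (Real.exp (f x) + Real.exp M * |f x - g x|) ∂(μ₀ : Measure X) := by
          refine integral_mono hhi (hei.add ((hdi _ inferInstance).const_mul _)) fun x => ?_
          have e1 : Real.exp (h x) * (f x - h x + 1) ≤ Real.exp (f x) := by
            calc Real.exp (h x) * (f x - h x + 1)
                ≤ Real.exp (h x) * Real.exp (f x - h x) := by
                  gcongr; exact Real.add_one_le_exp _
              _ = Real.exp (f x) := by rw [← Real.exp_add]; congr 1; ring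
          have hM : 0 ≤ M := (abs_nonneg _).trans (hfM x)
          have e2 : Real.exp (h x) ≤ Real.exp M :=
            Real.exp_le_exp.2 (by rw [hh]; exact max_le (by linarith) (min_le_left _ _))
          have e3 : Real.exp (h x) * -(f x - h x) ≤ Real.exp M * |f x - g x| :=
            (mul_le_mul_of_nonneg_left ((neg_le_abs _).trans (hfh x)) (Real.exp_pos _).le).trans
              (mul_le_mul_of_nonneg_right e2 (abs_nonneg _))
          simp only
          linarith
      _ = ∫ x, Real.exp (f x) ∂(μ₀ : Measure X) +
          Real.exp M * ∫ x, |f x - g x| ∂(μ₀ : Measure X) := by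
          rw [integral_add hei ((hdi _ inferInstance).const_mul _), integral_const_mul]
      _ ≤ _ := by gcongr; linarith
  have k3 := Real.log_le_log (integral_exp_pos hhi) k2
  linarith

/-- Local Sanov upper bound: by Chernoff's inequality for the exponential moment of a
Donsker–Varadhan test function, `N` independent points of law `μ₀` have empirical measure near `μ`
with probability at most `exp (-N a)`, whenever `a < D(μ | μ₀)`. -/
theorem exists_open_pi_empirical_le (μ μ₀ : ProbabilityMeasure X) {a : ℝ}
    (ha : (a : EReal) < (klDiv (μ : Measure X) μ₀ : ℝ≥0∞)) :
    ∃ U : Set (ProbabilityMeasure X), IsOpen U ∧ μ ∈ U ∧ ∀ N : ℕ+,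
      (Measure.pi fun _ : Fin (N : ℕ) => (μ₀ : Measure X)) (empirical N ⁻¹' U) ≤
        ENNReal.ofReal (Real.exp (-((N : ℕ) * a))) := by
  obtain ⟨f, hf⟩ := exists_continuous_of_lt_klDiv μ μ₀ ha
  set Z := ∫ x, Real.exp (f x) ∂(μ₀ : Measure X) with hZ
  have hei : Integrable (fun x => Real.exp (f x)) (μ₀ : Measure X) := by
    refine Integrable.of_bound (C := Real.exp ‖f‖) (Real.continuous_exp.comp
      f.continuous).aestronglyMeasurable (ae_of_all _ fun x => ?_)
    rw [Real.norm_eq_abs, abs_of_pos (Real.exp_pos _), Real.exp_le_exp]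
    exact (le_abs_self _).trans (f.norm_coe_le_norm x)
  have hZpos : 0 < Z := integral_exp_pos hei
  refine ⟨{ν | a + Real.log Z < ∫ x, f x ∂(ν : Measure X)},
    isOpen_lt continuous_const
      (ProbabilityMeasure.continuous_integral_boundedContinuousFunction f),
    by simpa using lt_sub_iff_add_lt.1 hf, fun N => ?_⟩
  have hNpos : (0 : ℝ) < (N : ℕ) := by exact_mod_cast N.pos
  have hmean : ∫⁻ x, ∏ i, ENNReal.ofReal (Real.exp (f (x i)))
      ∂(Measure.pi fun _ : Fin (N : ℕ) => (μ₀ : Measure X)) =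
      ENNReal.ofReal (Real.exp ((N : ℕ) * Real.log Z)) := by
    rw [lintegral_pi_prod (μ₀ : Measure X) (fun _ y => ENNReal.ofReal (Real.exp (f y)))
      fun _ => f.continuous.measurable.exp.ennreal_ofReal]
    rw [← ofReal_integral_eq_lintegral_ofReal hei (ae_of_all _ fun x => (Real.exp_pos _).le)]
    rw [Finset.prod_const, Finset.card_univ, Fintype.card_fin, ← ENNReal.ofReal_pow hZpos.le,
      Real.exp_nat_mul, Real.exp_log hZpos]
  set c := ENNReal.ofReal (Real.exp ((N : ℕ) * (a + Real.log Z))) with hc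
  have hmarkov := mul_meas_ge_le_lintegral₀
    (μ := Measure.pi fun _ : Fin (N : ℕ) => (μ₀ : Measure X))
    (f := fun x => ∏ i, ENNReal.ofReal (Real.exp (f (x i))))
    (Finset.measurable_prod _ fun i _ => (f.continuous.measurable.comp
      (measurable_pi_apply i)).exp.ennreal_ofReal).aemeasurable c
  have hsub : empirical N ⁻¹'
      {ν : ProbabilityMeasure X | a + Real.log Z < ∫ x, f x ∂(ν : Measure X)} ⊆
      {x | c ≤ ∏ i, ENNReal.ofReal (Real.exp (f (x i)))} := by
    intro x hx
    simp only [Set.mem_preimage, Set.mem_ofPred_eq, integral_empirical N x f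
      f.continuous.measurable] at hx ⊢
    rw [← ENNReal.ofReal_prod_of_nonneg fun i _ => (Real.exp_pos _).le, ← Real.exp_sum, hc]
    refine ENNReal.ofReal_le_ofReal (Real.exp_le_exp.2 ?_)
    rw [lt_div_iff₀ hNpos] at hx
    linarith
  have h1 : c * (Measure.pi fun _ : Fin (N : ℕ) => (μ₀ : Measure X))
      (empirical N ⁻¹' {ν | a + Real.log Z < ∫ x, f x ∂(ν : Measure X)}) ≤
      ENNReal.ofReal (Real.exp ((N : ℕ) * Real.log Z)) :=
    (mul_le_mul_right (measure_mono hsub) c).trans (hmarkov.trans hmean.le)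
  rw [mul_comm, ← ENNReal.le_div_iff_mul_le (Or.inl (by simp [hc, Real.exp_pos]))
    (Or.inl (by simp [hc]))] at h1
  refine h1.trans (le_of_eq ?_)
  rw [hc, ← ENNReal.ofReal_div_of_pos (Real.exp_pos _), ← Real.exp_sub]
  congr 2
  ring

end DonskerVaradhan

/-! ### Extended integrals and symmetrized configurations -/

section EIntegral

variable {α : Type*} [MeasurableSpace α] {μ : Measure α}

theorem eintegral_of_ae_eq_const [IsProbabilityMeasure μ] {f : α → EReal} {c : EReal}
    (h : ∀ᵐ x ∂μ, f x = c) : eintegral f μ = c := by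
  have h1 : ∫⁻ x, (f x).toENNReal ∂μ = c.toENNReal := by
    rw [lintegral_congr_ae (h.mono fun x hx => by rw [hx])]; simp
  have h2 : ∫⁻ x, (-f x).toENNReal ∂μ = (-c).toENNReal := by
    rw [lintegral_congr_ae (h.mono fun x hx => by rw [hx])]; simp
  rw [eintegral, h1, h2]
  rcases le_total 0 c with hc | hc
  · rw [EReal.coe_toENNReal hc, EReal.toENNReal_of_nonpos (by simpa using hc)]
    simp
  · rw [EReal.toENNReal_of_nonpos hc, EReal.coe_toENNReal (by simpa using hc)]
    simp

theorem eintegral_mono {f g : α → EReal} (h : ∀ x, f x ≤ g x) : eintegral f μ ≤ eintegral g μ := by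
  refine EReal.sub_le_sub ?_ ?_
  · exact EReal.coe_ennreal_le_coe_ennreal_iff.2
      (lintegral_mono fun x => EReal.toENNReal_le_toENNReal (h x))
  · exact EReal.coe_ennreal_le_coe_ennreal_iff.2
      (lintegral_mono fun x => EReal.toENNReal_le_toENNReal (EReal.neg_le_neg_iff.2 (h x)))

theorem eintegral_coe {g : α → ℝ} (hg : Integrable g μ) :
    eintegral (fun x => (g x : EReal)) μ = ((∫ x, g x ∂μ : ℝ) : EReal) := by
  rw [integral_eq_lintegral_pos_part_sub_lintegral_neg_part hg, eintegral, EReal.coe_sub]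
  have h1 : ∀ {h : α → ℝ}, Integrable h μ → ∫⁻ x, ENNReal.ofReal (h x) ∂μ ≠ ⊤ := fun hh =>
    hh.lintegral_lt_top.ne
  have h3 : ∀ t : ℝ, (t : EReal).toENNReal = ENNReal.ofReal t := fun t => by simp
  simp only [← EReal.coe_neg, h3]
  rw [EReal.coe_ennreal_toReal (h1 hg), EReal.coe_ennreal_toReal (h1 (h := fun x => -g x) hg.neg)]

end EIntegral

section Energy

variable {X : Type*} [MeasurableSpace X]

/-- Since `eintegral` is monotone without any integrability, a pointwise bound of `H` from below by
an integrable function passes to the mean energy. -/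
theorem coe_integral_le_meanEnergy {N : ℕ+} {HN : (Fin (N : ℕ) → X) → EReal}
    {ν : Measure (Fin (N : ℕ) → X)} {g : (Fin (N : ℕ) → X) → ℝ} (hg : Integrable g ν)
    (h : ∀ x, (((N : ℕ) * g x : ℝ) : EReal) ≤ HN x) :
    ((∫ x, g x ∂ν : ℝ) : EReal) ≤ meanEnergy N HN ν := by
  have hN : (0 : EReal) < ((N : ℕ) : EReal) := by exact_mod_cast N.pos
  rw [meanEnergy, EReal.le_div_iff_mul_le hN (EReal.natCast_ne_top _)]
  refine le_trans (le_of_eq ?_) (eintegral_mono h)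
  rw [eintegral_coe (hg.const_mul _), integral_const_mul]
  push_cast
  rw [mul_comm]

/-- The symmetrization `(1/N!) ∑ δ_{x ∘ σ}` of the Dirac mass at a configuration `x`. -/
noncomputable def symDirac {n : ℕ} (x : Fin n → X) : ProbabilityMeasure (Fin n → X) :=
  ⟨(Fintype.card (Equiv.Perm (Fin n)) : ℝ≥0∞)⁻¹ •
    ∑ σ : Equiv.Perm (Fin n), Measure.dirac (x ∘ σ), ⟨by
      simp only [Measure.smul_apply, Measure.finsetSum_apply, measure_univ, Finset.sum_const,
        Finset.card_univ, smul_eq_mul, nsmul_eq_mul, mul_one]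
      exact ENNReal.inv_mul_cancel (Nat.cast_ne_zero.2 Fintype.card_ne_zero)
        (ENNReal.natCast_ne_top _)⟩⟩

theorem coe_symDirac {n : ℕ} (x : Fin n → X) : (symDirac x : Measure (Fin n → X)) =
    (Fintype.card (Equiv.Perm (Fin n)) : ℝ≥0∞)⁻¹ •
      ∑ σ : Equiv.Perm (Fin n), Measure.dirac (x ∘ σ) := rfl

theorem measurable_comp_perm {n : ℕ} (σ : Equiv.Perm (Fin n)) :
    Measurable fun x : Fin n → X => x ∘ σ :=
  measurable_pi_lambda _ fun i => measurable_pi_apply (σ i)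

theorem isSymmetric_symDirac {n : ℕ} (x : Fin n → X) :
    IsSymmetric (symDirac x : Measure (Fin n → X)) := by
  intro τ
  rw [coe_symDirac, Measure.map_smul]
  congr 1
  rw [← Measure.mapₗ_apply_of_measurable (measurable_comp_perm τ), map_sum]
  simp only [Measure.mapₗ_apply_of_measurable (measurable_comp_perm τ),
    Measure.map_dirac' (measurable_comp_perm τ)]
  exact Equiv.sum_comp (Equiv.mulRight τ) fun σ : Equiv.Perm (Fin n) => Measure.dirac (x ∘ σ)

theorem isSymmetric_pi {n : ℕ} (μ : Measure X) [IsProbabilityMeasure μ] :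
    IsSymmetric (Measure.pi fun _ : Fin n => μ) := by
  intro σ
  refine (Measure.pi_eq fun s hs => ?_).symm
  rw [Measure.map_apply (measurable_comp_perm σ) (MeasurableSet.univ_pi hs)]
  have : (fun x : Fin n → X => x ∘ σ) ⁻¹' Set.univ.pi s = Set.univ.pi fun i => s (σ.symm i) := by
    ext x
    simp only [Set.mem_preimage, Set.mem_univ_pi, Function.comp_apply]
    exact ⟨fun h i => by simpa using h (σ.symm i), fun h i => by simpa using h (σ i)⟩
  rw [this, Measure.pi_pi]
  exact Equiv.prod_comp σ.symm fun i => μ (s i)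

theorem ae_symDirac [MeasurableSingletonClass X] {n : ℕ} {x : Fin n → X} {p : (Fin n → X) → Prop}
    (h : ∀ σ : Equiv.Perm (Fin n), p (x ∘ σ)) : ∀ᵐ y ∂(symDirac x : Measure (Fin n → X)), p y := by
  rw [coe_symDirac]
  refine Measure.ae_smul_measure ?_ _
  rw [ae_iff, Measure.finsetSum_apply]
  refine Finset.sum_eq_zero fun σ _ => ?_
  rw [← ae_iff, ae_dirac_eq]
  exact h σ

end Energy

/-! ### Pointwise bounds on the Hamiltonian -/

section LocalEnergy

variable {X : Type*} [TopologicalSpace X] [CompactSpace X] [TopologicalSpace.MetrizableSpace X]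
  [MeasurableSpace X] [BorelSpace X]

/-- Concentration near `μ` in probability is weak convergence of the laws to `δ_μ`. -/
theorem tendsto_map_empirical_dirac {ν : (N : ℕ+) → ProbabilityMeasure (Fin (N : ℕ) → X)}
    {μ : ProbabilityMeasure X}
    (h : ∀ U : Set (ProbabilityMeasure X), IsOpen U → μ ∈ U →
      Tendsto (fun N : ℕ+ => (ν N : Measure (Fin (N : ℕ) → X)) (empirical N ⁻¹' U)ᶜ) atTop (𝓝 0)) :
    Tendsto (fun N => (ν N).map (measurable_empirical N).aemeasurable) atTop
      (𝓝 (⟨Measure.dirac μ, inferInstance⟩ : ProbabilityMeasure (ProbabilityMeasure X))) := by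
  refine tendsto_of_forall_isOpen_le_liminf' fun G hG => ?_
  by_cases hμ : μ ∈ G
  · have h1 : Tendsto (fun N : ℕ+ => (ν N : Measure (Fin (N : ℕ) → X)) (empirical N ⁻¹' G)) atTop
        (𝓝 1) := by
      have h2 := ENNReal.Tendsto.sub (tendsto_const_nhds (x := (1 : ℝ≥0∞))) (h G hG hμ)
        (Or.inl ENNReal.one_ne_top)
      rw [tsub_zero] at h2
      refine h2.congr fun N => ?_
      have hm : MeasurableSet (empirical N ⁻¹' G : Set (Fin (N : ℕ) → X)) :=
        measurable_empirical N hG.measurableSet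
      rw [← prob_compl_eq_one_sub hm.compl, compl_compl]
    have h3 : ∀ N : ℕ+, (((ν N).map (measurable_empirical N).aemeasurable :
        ProbabilityMeasure (ProbabilityMeasure X)) : Measure (ProbabilityMeasure X)) G =
        (ν N : Measure (Fin (N : ℕ) → X)) (empirical N ⁻¹' G) := fun N =>
      ProbabilityMeasure.map_apply' _ _ hG.measurableSet
    simp only [h3, h1.liminf_eq]
    exact prob_le_one (μ := Measure.dirac μ)
  · rw [ProbabilityMeasure.coe_mk, Measure.dirac_apply' _ hG.measurableSet,
      Set.indicator_of_notMem hμ]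
    exact zero_le

variable {H : (N : ℕ+) → (Fin (N : ℕ) → X) → EReal} {E : ProbabilityMeasure X → EReal}

/-- The lower bound on the mean energy, tested on symmetrized Dirac masses, is a pointwise lower
bound on the Hamiltonian: `H ≥ N a` on all configurations with empirical measure near `μ`, whenever
`a < E μ`. Otherwise there are violating configurations of sizes `N k → ∞` whose empirical measures
tend to `μ`; completing them by the product measures `μ^{⊗N}` at the other sizes gives a sequence
that contradicts the hypothesis with `Γ = δ_μ`. -/
theorem HypH2.exists_open_le (h2 : HypH2 H E)
    (hH_symm : ∀ (N : ℕ+) (σ : Equiv.Perm (Fin (N : ℕ))) (x : Fin (N : ℕ) → X),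
      H N (x ∘ σ) = H N x) {μ : ProbabilityMeasure X} {a : ℝ} (ha : (a : EReal) < E μ) :
    ∃ U : Set (ProbabilityMeasure X), IsOpen U ∧ μ ∈ U ∧
      ∀ᶠ N : ℕ+ in atTop, ∀ x, empirical N x ∈ U → (((N : ℕ) * a : ℝ) : EReal) ≤ H N x := by
  by_contra! hcon
  have : Nonempty X := μ.nonempty
  obtain ⟨s, hs⟩ := (𝓝 μ).exists_antitone_basis
  have hfreq : ∀ k : ℕ, ∃ᶠ m : ℕ in atTop, ∃ x : Fin (m.succPNat : ℕ) → X,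
      empirical m.succPNat x ∈ s k ∧ H m.succPNat x < (((m.succPNat : ℕ) * a : ℝ) : EReal) := by
    intro k
    have h1 := hcon (interior (s k)) isOpen_interior (mem_interior_iff_mem_nhds.2 (hs.mem k))
    rw [frequently_atTop] at h1 ⊢
    intro m
    obtain ⟨N, hN, x, hx⟩ := h1 m.succPNat
    obtain ⟨n, rfl⟩ : ∃ n : ℕ, N = n.succPNat := ⟨N.natPred, by simp⟩
    exact ⟨n, by simpa using hN, x, interior_subset hx.1, hx.2⟩
  obtain ⟨φ, hφ, hφx⟩ := extraction_forall_of_frequently hfreq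
  set S : Set ℕ+ := Set.range fun k => (φ k).succPNat with hS
  have hy : ∀ N ∈ S, ∃ x : Fin (N : ℕ) → X, (∀ k, N = (φ k).succPNat → empirical N x ∈ s k) ∧
      H N x < (((N : ℕ) * a : ℝ) : EReal) := by
    rintro N ⟨k, rfl⟩
    obtain ⟨x, h3, h4⟩ := hφx k
    refine ⟨x, fun l hl => ?_, h4⟩
    obtain rfl : k = l := hφ.injective (Nat.succPNat_injective hl)
    exact h3
  choose! y hys hyH using hy
  classical
  -- violating configurations at the sizes in `S`, product measures at all other sizes
  set ν : (N : ℕ+) → ProbabilityMeasure (Fin (N : ℕ) → X) := fun N =>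
    if N ∈ S then symDirac (y N) else ⟨Measure.pi fun _ => (μ : Measure X), inferInstance⟩ with hν
  have hν1 : ∀ N ∈ S, ν N = symDirac (y N) := fun N hN => if_pos hN
  have hν2 : ∀ N ∉ S, ν N = ⟨Measure.pi fun _ => (μ : Measure X), inferInstance⟩ :=
    fun N hN => if_neg hN
  have hsymm : ∀ N : ℕ+, IsSymmetric (ν N : Measure (Fin (N : ℕ) → X)) := by
    intro N
    by_cases hN : N ∈ S
    · rw [hν1 N hN]
      exact isSymmetric_symDirac _
    · rw [hν2 N hN]
      exact isSymmetric_pi _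
  have hlim := h2 ν hsymm ⟨Measure.dirac μ, inferInstance⟩ (tendsto_map_empirical_dirac ?_)
  · have h5 : eintegral E (Measure.dirac μ) = E μ :=
      eintegral_of_ae_eq_const (by rw [ae_dirac_eq]; rfl)
    rw [ProbabilityMeasure.coe_mk, h5] at hlim
    refine (ha.trans_le hlim).not_ge (liminf_le_of_frequently_le ?_ (by isBoundedDefault))
    have h6 : ∀ N ∈ S, meanEnergy N (H N) (ν N : Measure (Fin (N : ℕ) → X)) ≤ a := by
      intro N hN
      have h7 : eintegral (H N) (symDirac (y N) : Measure (Fin (N : ℕ) → X)) = H N (y N) :=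
        eintegral_of_ae_eq_const (ae_symDirac fun σ => hH_symm N σ (y N))
      rw [hν1 N hN, meanEnergy, h7, EReal.div_le_iff_le_mul (by exact_mod_cast N.pos)
        (EReal.natCast_ne_top _)]
      exact (hyH N hN).le.trans (le_of_eq (by push_cast; rfl))
    rw [frequently_atTop]
    intro N
    refine ⟨(φ N).succPNat, ?_, h6 _ ⟨N, rfl⟩⟩
    rw [← PNat.coe_le_coe]
    exact (hφ.le_apply (x := (N : ℕ))).trans (by simp)
  · intro U hU hμU
    obtain ⟨k, -, hk⟩ := hs.toHasBasis.mem_iff.1 (hU.mem_nhds hμU)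
    refine tendsto_of_tendsto_of_tendsto_of_le_of_le' tendsto_const_nhds
      (tendsto_pi_empirical_compl μ (hU.mem_nhds hμU)) (Eventually.of_forall fun _ => zero_le) ?_
    filter_upwards [eventually_ge_atTop (φ k).succPNat] with N hNk
    by_cases hN : N ∈ S
    · have h8 : empirical N (y N) ∈ U := by
        obtain ⟨l, hl⟩ := hN
        have hkl : k ≤ l := by
          rw [← hl, Nat.succPNat_le_succPNat] at hNk
          exact hφ.le_iff_le.1 hNk
        exact hk (hs.antitone hkl (hys N ⟨l, hl⟩ l hl.symm))
      rw [hν1 N hN]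
      refine le_of_eq_of_le ?_ zero_le
      have : ∀ᵐ z ∂(symDirac (y N) : Measure (Fin (N : ℕ) → X)), empirical N z ∈ U :=
        ae_symDirac fun σ => by rwa [empirical_comp_perm]
      exact this
    · rw [hν2 N hN]
      rfl

/-- By compactness of `P(X)`, the Hamiltonian is bounded below by a multiple of `N`. -/
theorem HypH2.exists_global_le (h2 : HypH2 H E)
    (hH_symm : ∀ (N : ℕ+) (σ : Equiv.Perm (Fin (N : ℕ))) (x : Fin (N : ℕ) → X),
      H N (x ∘ σ) = H N x) (hE_bot : ∀ μ, E μ ≠ ⊥) :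
    ∃ C : ℝ, ∀ᶠ N : ℕ+ in atTop, ∀ x, (((N : ℕ) * C : ℝ) : EReal) ≤ H N x := by
  have key := isCompact_univ.induction_on (s := (Set.univ : Set (ProbabilityMeasure X)))
    (p := fun s => ∃ C : ℝ, ∀ᶠ N : ℕ+ in atTop, ∀ x, empirical N x ∈ s →
      (((N : ℕ) * C : ℝ) : EReal) ≤ H N x) ⟨0, by simp⟩ ?_ ?_ ?_
  · simpa using key
  · rintro s t hst ⟨C, hC⟩
    exact ⟨C, hC.mono fun N h x hx => h x (hst hx)⟩
  · rintro s t ⟨C, hC⟩ ⟨D, hD⟩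
    refine ⟨min C D, ?_⟩
    filter_upwards [hC, hD] with N h3 h4 x hx
    rcases hx with hx | hx
    · refine le_trans (EReal.coe_le_coe_iff.2 ?_) (h3 x hx)
      gcongr
      exact min_le_left _ _
    · refine le_trans (EReal.coe_le_coe_iff.2 ?_) (h4 x hx)
      gcongr
      exact min_le_right _ _
  · intro μ _
    obtain ⟨a, -, ha⟩ := EReal.lt_iff_exists_real_btwn.1 (bot_lt_iff_ne_bot.2 (hE_bot μ))
    obtain ⟨U, hU, hμ, h⟩ := h2.exists_open_le hH_symm ha
    exact ⟨U, mem_nhdsWithin_of_mem_nhds (hU.mem_nhds hμ), a, h⟩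

/-- Under `μ^{⊗N}` the energy per particle is at most `E μ + δ` with probability bounded below: it
is almost bounded below by `E μ`, which is also the limit of its mean, so Markov's inequality
applies to the excess. -/
theorem eventually_pi_energy_gt_le (h2 : HypH2 H E) (hH_meas : ∀ N, Measurable (H N))
    (hH_symm : ∀ (N : ℕ+) (σ : Equiv.Perm (Fin (N : ℕ))) (x : Fin (N : ℕ) → X),
      H N (x ∘ σ) = H N x) (hE_bot : ∀ μ, E μ ≠ ⊥) {μ : ProbabilityMeasure X} {e : ℝ}
    (he : E μ = e)
    (hlim : Tendsto (fun N : ℕ+ => meanEnergy N (H N) (Measure.pi fun _ => (μ : Measure X))) atTop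
      (𝓝 (E μ))) {δ : ℝ} (hδ : 0 < δ) :
    ∀ᶠ N : ℕ+ in atTop, (Measure.pi fun _ : Fin (N : ℕ) => (μ : Measure X)).real
      {x | (((N : ℕ) * (e + δ) : ℝ) : EReal) < H N x} ≤ 1 / 4 := by
  obtain ⟨U, hU, hμU, hloc⟩ := h2.exists_open_le hH_symm (μ := μ) (a := e - δ / 12)
    (by rw [he]; exact_mod_cast (by linarith : e - δ / 12 < e))
  obtain ⟨C, hC⟩ := h2.exists_global_le hH_symm hE_bot
  -- below, `H / N` is bounded from below by `e - δ/12`, raised by `13δ/12` on the bad event `B` and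
  -- lowered by `K` where the empirical measure is outside `U`; `K` makes this true by `C ≤ H / N`
  set K := |C| + |e| + δ with hK
  have hKpos : 0 < K := by positivity
  have hA : ∀ᶠ N : ℕ+ in atTop, (Measure.pi fun _ : Fin (N : ℕ) => (μ : Measure X)).real
      (empirical N ⁻¹' U)ᶜ < δ / 12 / K := by
    have h3 := (ENNReal.tendsto_toReal ENNReal.zero_ne_top).comp
      (tendsto_pi_empirical_compl μ (hU.mem_nhds hμU))
    rw [ENNReal.toReal_zero] at h3
    exact h3.eventually_lt_const (by positivity)
  have hm : ∀ᶠ N : ℕ+ in atTop, meanEnergy N (H N) (Measure.pi fun _ => (μ : Measure X)) <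
      ((e + δ / 12 : ℝ) : EReal) := by
    refine hlim.eventually_lt_const ?_
    rw [he]
    exact_mod_cast (by linarith : e < e + δ / 12)
  filter_upwards [hloc, hC, hA, hm] with N h3 h4 h5 h6
  set P := Measure.pi fun _ : Fin (N : ℕ) => (μ : Measure X)
  set A : Set (Fin (N : ℕ) → X) := (empirical N ⁻¹' U)ᶜ with hAdef
  set B : Set (Fin (N : ℕ) → X) := {x | (((N : ℕ) * (e + δ) : ℝ) : EReal) < H N x} with hBdef
  have hAm : MeasurableSet A := (measurable_empirical N hU.measurableSet).compl
  have hBm : MeasurableSet B := measurableSet_lt measurable_const (hH_meas N)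
  have i1 : Integrable (fun _ : Fin (N : ℕ) → X => e - δ / 12) P := integrable_const _
  have i2 : Integrable (B.indicator fun _ => (13 / 12 * δ : ℝ)) P :=
    (integrable_const _).indicator hBm
  have i3 : Integrable (A.indicator fun _ => K) P := (integrable_const _).indicator hAm
  have i12 : Integrable (fun x => (e - δ / 12) + B.indicator (fun _ => 13 / 12 * δ) x) P :=
    i1.add i2
  have h7 := coe_integral_le_meanEnergy (N := N) (HN := H N) (ν := P)
    (g := fun x => (e - δ / 12) + B.indicator (fun _ => 13 / 12 * δ) x - A.indicator (fun _ => K) x)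
    (i12.sub i3) fun x => by
      have hN0 : (0 : ℝ) ≤ (N : ℕ) := Nat.cast_nonneg _
      have hK0 : 0 ≤ A.indicator (fun _ => K) x := Set.indicator_nonneg (fun _ _ => hKpos.le) x
      by_cases hB : x ∈ B
      · refine le_trans (EReal.coe_le_coe_iff.2 ?_) (le_of_lt (show _ < H N x from hB))
        rw [Set.indicator_of_mem hB]
        gcongr
        linarith
      · rw [Set.indicator_of_notMem hB]
        by_cases hA' : x ∈ A
        · refine le_trans (EReal.coe_le_coe_iff.2 ?_) (h4 x)
          rw [Set.indicator_of_mem hA']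
          refine mul_le_mul_of_nonneg_left ?_ hN0
          linarith [neg_abs_le C, le_abs_self e]
        · refine le_trans (EReal.coe_le_coe_iff.2 ?_) (h3 x (not_not.1 hA'))
          refine mul_le_mul_of_nonneg_left ?_ hN0
          linarith
  have h8 := EReal.coe_lt_coe_iff.1 (h7.trans_lt h6)
  rw [integral_sub i12 i3, integral_add i1 i2, integral_indicator_const _ hBm,
    integral_indicator_const _ hAm] at h8
  simp only [integral_const, probReal_univ, smul_eq_mul, one_mul] at h8
  rw [lt_div_iff₀ hKpos] at h5
  have h9 : 0 ≤ P.real B := measureReal_nonneg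
  nlinarith

end LocalEnergy

/-! ### Boltzmann weights and change of measure -/

section Boltzmann

variable {X : Type*} [MeasurableSpace X] {N : ℕ+} {b : ℝ} {HN : (Fin (N : ℕ) → X) → EReal}
  {μ₀ : ProbabilityMeasure X} {A : Set (Fin (N : ℕ) → X)} {a : ℝ}

theorem boltzmann_le (hb : 0 ≤ b) (hA : MeasurableSet A) (h : ∀ x ∈ A, (a : EReal) ≤ HN x) :
    boltzmann N b HN μ₀ A ≤ ENNReal.ofReal (Real.exp (-(b * a))) *
      (Measure.pi fun _ => (μ₀ : Measure X)) A := by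
  rw [boltzmann, withDensity_apply _ hA, ← setLIntegral_const]
  refine setLIntegral_mono' hA fun x hx => ?_
  rw [← EReal.exp_coe, EReal.coe_neg, EReal.coe_mul, EReal.exp_le_exp_iff, EReal.neg_le_neg_iff]
  exact mul_le_mul_of_nonneg_left (h x hx) (by exact_mod_cast hb)

theorem le_boltzmann (hb : 0 ≤ b) (hA : MeasurableSet A) (h : ∀ x ∈ A, HN x ≤ (a : EReal)) :
    ENNReal.ofReal (Real.exp (-(b * a))) * (Measure.pi fun _ => (μ₀ : Measure X)) A ≤
      boltzmann N b HN μ₀ A := by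
  rw [boltzmann, withDensity_apply _ hA, ← setLIntegral_const]
  refine setLIntegral_mono' hA fun x hx => ?_
  rw [← EReal.exp_coe, EReal.coe_neg, EReal.coe_mul, EReal.exp_le_exp_iff, EReal.neg_le_neg_iff]
  exact mul_le_mul_of_nonneg_left (h x hx) (by exact_mod_cast hb)

/-- Only an inequality, as `log 0 = 0` when a factor vanishes. -/
theorem prod_le_exp_sum_log {n : ℕ} (u : Fin n → ℝ) (hu : ∀ i, 0 ≤ u i) :
    ∏ i, u i ≤ Real.exp (∑ i, Real.log (u i)) := by
  by_cases h : ∃ i, u i = 0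
  · obtain ⟨i, hi⟩ := h
    rw [Finset.prod_eq_zero (Finset.mem_univ i) hi]
    exact (Real.exp_pos _).le
  · push Not at h
    rw [Real.exp_sum]
    exact (Finset.prod_congr rfl fun i _ =>
      (Real.exp_log (lt_of_le_of_ne (hu i) (h i).symm)).symm).le

/-- Change of measure: `μ^{⊗N} ≤ exp c · μ₀^{⊗N}` on sets where the log-likelihood ratio is at
most `c`. -/
theorem pi_le_exp_mul_pi {n : ℕ} {μ ν : Measure X} [IsProbabilityMeasure μ]
    [IsProbabilityMeasure ν] (hac : μ ≪ ν) {A : Set (Fin n → X)} (hA : MeasurableSet A) {c : ℝ}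
    (h : ∀ x ∈ A, ∑ i, llr μ ν (x i) ≤ c) :
    (Measure.pi fun _ : Fin n => μ) A ≤
      ENNReal.ofReal (Real.exp c) * (Measure.pi fun _ : Fin n => ν) A := by
  -- the density, made finite everywhere
  set f : X → ℝ≥0∞ := fun x => ENNReal.ofReal (μ.rnDeriv ν x).toReal with hf
  have hfm : Measurable f := (Measure.measurable_rnDeriv μ ν).ennreal_toReal.ennreal_ofReal
  have hμ : ν.withDensity f = μ := by
    refine (withDensity_congr_ae ?_).trans (Measure.withDensity_rnDeriv_eq μ ν hac)
    filter_upwards [Measure.rnDeriv_lt_top μ ν] with x hx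
    exact ENNReal.ofReal_toReal hx.ne
  have hP : IsProbabilityMeasure (ν.withDensity f) := hμ.symm ▸ inferInstance
  have hpi := pi_withDensity (n := n) ν f hfm
  rw [hμ] at hpi
  rw [hpi, withDensity_apply _ hA, ← setLIntegral_const]
  refine setLIntegral_mono' hA fun x hx => ?_
  rw [hf, ← ENNReal.ofReal_prod_of_nonneg fun i _ => ENNReal.toReal_nonneg]
  exact ENNReal.ofReal_le_ofReal ((prod_le_exp_sum_log _ fun i => ENNReal.toReal_nonneg).trans
    (Real.exp_le_exp.2 (h x hx)))

end Boltzmann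

section GibbsFreeEnergy

variable {X : Type*} [MeasurableSpace X] {E : ProbabilityMeasure X → EReal}
  {μ₀ : ProbabilityMeasure X} {β : EReal}

theorem freeEnergy_ne_bot (hE_bot : ∀ μ, E μ ≠ ⊥) (hβ_pos : 0 < β) (μ : ProbabilityMeasure X) :
    freeEnergy μ₀ E β μ ≠ ⊥ := by
  have h0 : (0 : EReal) ≤
      if β = ⊤ then 0 else ((klDiv (μ : Measure X) μ₀ : ℝ≥0∞) : EReal) / β := by
    split_ifs
    · exact le_rfl
    · exact EReal.div_nonneg (EReal.coe_ennreal_nonneg _) hβ_pos.le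
  rw [freeEnergy, Ne, EReal.add_eq_bot_iff, not_or]
  exact ⟨hE_bot μ, ne_bot_of_le_ne_bot EReal.zero_ne_bot h0⟩

theorem freeEnergy_self_lt_top (h : E μ₀ < ⊤) : freeEnergy μ₀ E β μ₀ < ⊤ := by
  simpa [freeEnergy, klDiv_self] using h

/-- The partition function is the total mass of the image of the Boltzmann measure. -/
theorem map_gibbs (μ₀ : ProbabilityMeasure X) (N : ℕ+) (b : ℝ) (HN : (Fin (N : ℕ) → X) → EReal) :
    (gibbs N b HN μ₀).map (empirical N) =
      ((boltzmann N b HN μ₀).map (empirical N) Set.univ)⁻¹ •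
        (boltzmann N b HN μ₀).map (empirical N) := by
  rw [gibbs, Measure.map_smul, Measure.map_apply (measurable_empirical N) MeasurableSet.univ,
    Set.preimage_univ, boltzmann,
    withDensity_apply _ MeasurableSet.univ, Measure.restrict_univ]
  rfl

end GibbsFreeEnergy

/-! ### Local bounds for the Boltzmann measures -/

section Bounds

variable {X : Type*} [TopologicalSpace X] [CompactSpace X] [TopologicalSpace.MetrizableSpace X]
  [MeasurableSpace X] [BorelSpace X]
  {H : (N : ℕ+) → (Fin (N : ℕ) → X) → EReal} {E : ProbabilityMeasure X → EReal}
  {μ₀ : ProbabilityMeasure X}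

/-- Lower bound for the Boltzmann measures near a measure `μ` of finite energy `e` and finite
relative entropy `d`. With probability at least `1/4` under `μ^{⊗N}`, the empirical measure lies in
`G`, the energy is at most `N (e + δ)` and the log-likelihood ratio is at most `N (d + δ)`; on this
event both the Boltzmann weight and the change of measure are controlled. -/
theorem eventually_le_boltzmann (h1 : HypH1 H μ₀ E) (h2 : HypH2 H E)
    (hH_meas : ∀ N, Measurable (H N))
    (hH_symm : ∀ (N : ℕ+) (σ : Equiv.Perm (Fin (N : ℕ))) (x : Fin (N : ℕ) → X),
      H N (x ∘ σ) = H N x) (hE_bot : ∀ μ, E μ ≠ ⊥) {μ : ProbabilityMeasure X} {e : ℝ}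
    (he : E μ = e) (hkl : klDiv (μ : Measure X) μ₀ ≠ ⊤) {δ : ℝ} (hδ : 0 < δ)
    {G : Set (ProbabilityMeasure X)} (hG : IsOpen G) (hμ : μ ∈ G) :
    ∀ᶠ N : ℕ+ in atTop, ∀ b : ℝ, 0 ≤ b →
      ENNReal.ofReal (Real.exp (-(b * ((N : ℕ) * (e + δ))) -
        (N : ℕ) * ((klDiv (μ : Measure X) μ₀).toReal + δ)) / 4) ≤
      boltzmann N b (H N) μ₀ (empirical N ⁻¹' G) := by
  obtain ⟨hac, hint⟩ := klDiv_ne_top_iff.1 hkl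
  set d := (klDiv (μ : Measure X) μ₀).toReal with hd
  have hd' : d = ∫ x, llr (μ : Measure X) μ₀ x ∂(μ : Measure X) :=
    toReal_klDiv_of_measure_eq hac (by simp)
  have hreal : ∀ {u : ℕ+ → ℝ≥0∞}, Tendsto u atTop (𝓝 0) → ∀ᶠ N in atTop, (u N).toReal ≤ 1 / 4 := by
    intro u hu
    have := (ENNReal.tendsto_toReal ENNReal.zero_ne_top).comp hu
    rw [ENNReal.toReal_zero] at this
    exact this.eventually_le_const (by norm_num)
  filter_upwards [eventually_pi_energy_gt_le h2 hH_meas hH_symm hE_bot he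
      (h1.1 μ (he ▸ EReal.coe_lt_top e)) hδ,
    hreal (tendsto_pi_empirical_compl μ (hG.mem_nhds hμ)),
    hreal (tendsto_pi_average (μ : Measure X) (measurable_llr _ _) hint hδ)] with N hB hA hL b hb
  rw [← hd'] at hL
  have hN0 : (0 : ℝ) < (N : ℕ) := by exact_mod_cast N.pos
  set P := Measure.pi fun _ : Fin (N : ℕ) => (μ : Measure X) with hP
  set A : Set (Fin (N : ℕ) → X) := empirical N ⁻¹' G with hAdef
  set B : Set (Fin (N : ℕ) → X) := {x | (((N : ℕ) * (e + δ) : ℝ) : EReal) < H N x} with hBdef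
  set L : Set (Fin (N : ℕ) → X) :=
    {x | δ ≤ dist ((∑ i, llr (μ : Measure X) μ₀ (x i)) / (N : ℕ)) d} with hLdef
  have hAm : MeasurableSet A := measurable_empirical N hG.measurableSet
  have hBm : MeasurableSet B := measurableSet_lt measurable_const (hH_meas N)
  have hLm : MeasurableSet L := by
    have : Measurable fun x : Fin (N : ℕ) → X =>
        dist ((∑ i, llr (μ : Measure X) μ₀ (x i)) / (N : ℕ)) d :=
      ((Finset.measurable_sum _ fun i _ => (measurable_llr _ _).comp
        (measurable_pi_apply i)).div_const _).dist measurable_const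
    exact measurableSet_le measurable_const this
  set T : Set (Fin (N : ℕ) → X) := (Aᶜ ∪ B ∪ L)ᶜ with hTdef
  have hTm : MeasurableSet T := ((hAm.compl.union hBm).union hLm).compl
  have hPT : 1 / 4 ≤ P.real T := by
    rw [hTdef, probReal_compl_eq_one_sub ((hAm.compl.union hBm).union hLm)]
    have k1 := measureReal_union_le (μ := P) (Aᶜ ∪ B) L
    have k2 := measureReal_union_le (μ := P) Aᶜ B
    have k3 : P.real Aᶜ ≤ 1 / 4 := hA
    have k4 : P.real L ≤ 1 / 4 := hL
    linarith
  have hTA : T ⊆ A := fun x hx => by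
    by_contra h
    exact hx (Or.inl (Or.inl h))
  have hTB : ∀ x ∈ T, H N x ≤ (((N : ℕ) * (e + δ) : ℝ) : EReal) := fun x hx =>
    le_of_not_gt fun h => hx (Or.inl (Or.inr h))
  have hTL : ∀ x ∈ T, ∑ i, llr (μ : Measure X) μ₀ (x i) ≤ (N : ℕ) * (d + δ) := fun x hx => by
    have k1 : dist ((∑ i, llr (μ : Measure X) μ₀ (x i)) / (N : ℕ)) d < δ :=
      lt_of_not_ge fun h => hx (Or.inr h)
    have k2 := (abs_lt.1 (Real.dist_eq _ _ ▸ k1)).2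
    have k3 : (∑ i, llr (μ : Measure X) μ₀ (x i)) / (N : ℕ) < d + δ := by linarith
    rw [div_lt_iff₀ hN0] at k3
    linarith
  have hQ := pi_le_exp_mul_pi hac hTm hTL
  have hW := (le_boltzmann (μ₀ := μ₀) hb hTm hTB).trans (measure_mono hTA)
  refine le_trans ?_ hW
  set Q := Measure.pi fun _ : Fin (N : ℕ) => (μ₀ : Measure X)
  have hP4 : ENNReal.ofReal (1 / 4) ≤ P T := by
    rw [← ofReal_measureReal]
    exact ENNReal.ofReal_le_ofReal hPT
  calc ENNReal.ofReal (Real.exp (-(b * ((N : ℕ) * (e + δ))) - (N : ℕ) * (d + δ)) / 4)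
      = ENNReal.ofReal (Real.exp (-(b * ((N : ℕ) * (e + δ))))) *
        (ENNReal.ofReal (Real.exp (-((N : ℕ) * (d + δ)))) * ENNReal.ofReal (1 / 4)) := by
        rw [← ENNReal.ofReal_mul (Real.exp_pos _).le, ← ENNReal.ofReal_mul (Real.exp_pos _).le,
          sub_eq_add_neg, Real.exp_add, div_eq_mul_one_div, mul_assoc (Real.exp _)]
    _ ≤ ENNReal.ofReal (Real.exp (-(b * ((N : ℕ) * (e + δ))))) *
        (ENNReal.ofReal (Real.exp (-((N : ℕ) * (d + δ)))) *
          (ENNReal.ofReal (Real.exp ((N : ℕ) * (d + δ))) * Q T)) := by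
        gcongr
        exact hP4.trans hQ
    _ = ENNReal.ofReal (Real.exp (-(b * ((N : ℕ) * (e + δ))))) * Q T := by
        congr 1
        rw [← mul_assoc, ← ENNReal.ofReal_mul (Real.exp_pos _).le, ← Real.exp_add]
        simp

variable {b : ℕ+ → ℝ} {β : EReal}

theorem map_empirical_apply (N : ℕ+) (ν : Measure (Fin (N : ℕ) → X))
    {U : Set (ProbabilityMeasure X)} (hU : IsOpen U) :
    ν.map (empirical N) U = ν (empirical N ⁻¹' U) :=
  Measure.map_apply (measurable_empirical N) hU.measurableSet

/-- Upper half of the large deviation principle. For `β < ∞` the level `a < E μ + D / β` is split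
between energy and entropy; for `β = ∞` the pointwise bound on the Hamiltonian suffices. -/
theorem localUpper_boltzmann (h2 : HypH2 H E)
    (hH_symm : ∀ (N : ℕ+) (σ : Equiv.Perm (Fin (N : ℕ))) (x : Fin (N : ℕ) → X),
      H N (x ∘ σ) = H N x) (hb_pos : ∀ N, 0 < b N) (hβ_pos : 0 < β)
    (hb_lim : Tendsto (fun N => (b N : EReal)) atTop (𝓝 β)) :
    LocalUpper (fun N => (boltzmann N (b N) (H N) μ₀).map (empirical N))
      (fun N => b N * (N : ℕ)) (freeEnergy μ₀ E β) := by
  intro μ a ha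
  by_cases hβ : β = ⊤
  · simp only [freeEnergy, if_pos hβ, add_zero] at ha
    obtain ⟨U, hU, hμ, hle⟩ := h2.exists_open_le hH_symm ha
    refine ⟨U, hU, hμ, ?_⟩
    filter_upwards [hle] with N hN
    rw [map_empirical_apply _ _ hU]
    refine (boltzmann_le (hb_pos N).le (measurable_empirical N hU.measurableSet)
      fun x hx => hN x hx).trans ?_
    rw [mul_assoc]
    exact mul_le_of_le_one_right zero_le prob_le_one
  · obtain ⟨t, rfl⟩ : ∃ t : ℝ, β = t :=
      ⟨β.toReal, (EReal.coe_toReal hβ (bot_lt_of_lt hβ_pos).ne').symm⟩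
    have ht : 0 < t := by exact_mod_cast hβ_pos
    have hb' : Tendsto b atTop (𝓝 t) := EReal.tendsto_coe.1 hb_lim
    simp only [freeEnergy, if_neg hβ] at ha
    obtain ⟨a₁, a₂, h3, h4, h5⟩ : ∃ a₁ a₂ : ℝ, (a₁ : EReal) < E μ ∧
        (a₂ : EReal) < ((klDiv (μ : Measure X) μ₀ : ℝ≥0∞) : EReal) / t ∧ a < a₁ + a₂ := by
      obtain ⟨a', ha1, ha2⟩ := EReal.lt_iff_exists_real_btwn.1 ha
      by_contra! hcon
      refine ha2.not_ge (EReal.add_le_of_forall_lt fun u hu v hv => ?_)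
      obtain ⟨u', hu1, hu2⟩ := EReal.lt_iff_exists_real_btwn.1 hu
      obtain ⟨v', hv1, hv2⟩ := EReal.lt_iff_exists_real_btwn.1 hv
      refine (add_le_add hu1.le hv1.le).trans (le_trans ?_ ha1.le)
      exact_mod_cast hcon u' v' hu2 hv2
    rw [EReal.lt_div_iff (by exact_mod_cast ht) (EReal.coe_ne_top t), ← EReal.coe_mul] at h4
    obtain ⟨U, hU, hμU, hle⟩ := h2.exists_open_le hH_symm h3
    obtain ⟨V, hV, hμV, hlV⟩ := exists_open_pi_empirical_le μ μ₀ h4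
    refine ⟨U ∩ V, hU.inter hV, ⟨hμU, hμV⟩, ?_⟩
    have hlim : Tendsto (fun N => b N * (a₁ - a) + a₂ * t) atTop (𝓝 (t * (a₁ - a) + a₂ * t)) :=
      (hb'.mul_const _).add_const _
    have hpos : 0 < t * (a₁ - a) + a₂ * t := by nlinarith
    filter_upwards [hle, hlim.eventually_const_lt hpos] with N hN hbN
    rw [map_empirical_apply _ _ (hU.inter hV)]
    refine (boltzmann_le (hb_pos N).le (measurable_empirical N (hU.inter hV).measurableSet)
      fun x hx => hN x hx.1).trans ?_
    refine (mul_le_mul_right ((measure_mono (Set.preimage_mono Set.inter_subset_right)).trans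
      (hlV N)) _).trans ?_
    rw [← ENNReal.ofReal_mul (Real.exp_pos _).le, ← Real.exp_add]
    refine ENNReal.ofReal_le_ofReal (Real.exp_le_exp.2 ?_)
    have hN0 : (0 : ℝ) < (N : ℕ) := by exact_mod_cast N.pos
    nlinarith

/-- Lower half of the large deviation principle. For `β = ∞`, where `μ` may have infinite entropy,
it is applied at an approximant of `μ` from `HypH3` that still lies in `G`. -/
theorem localLower_boltzmann (h1 : HypH1 H μ₀ E) (h2 : HypH2 H E)
    (hH_meas : ∀ N, Measurable (H N))
    (hH_symm : ∀ (N : ℕ+) (σ : Equiv.Perm (Fin (N : ℕ))) (x : Fin (N : ℕ) → X),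
      H N (x ∘ σ) = H N x) (hE_bot : ∀ μ, E μ ≠ ⊥) (hb_pos : ∀ N, 0 < b N) (hβ_pos : 0 < β)
    (hb_lim : Tendsto (fun N => (b N : EReal)) atTop (𝓝 β)) (h3 : β = ⊤ → HypH3 μ₀ E) :
    LocalLower (fun N => (boltzmann N (b N) (H N) μ₀).map (empirical N))
      (fun N => b N * (N : ℕ)) (freeEnergy μ₀ E β) := by
  intro μ a ha G hG hμ
  -- it suffices to beat the factor `1/4` by an exponential margin `κ N`
  have key : ∀ ν ∈ G, ∀ e : ℝ, E ν = e → klDiv (ν : Measure X) μ₀ ≠ ⊤ → ∀ δ > 0, ∀ κ > 0,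
      (∀ᶠ N in atTop, κ ≤ b N * (a - e - δ) - ((klDiv (ν : Measure X) μ₀).toReal + δ)) →
      ∀ᶠ N : ℕ+ in atTop, ENNReal.ofReal (Real.exp (-(b N * (N : ℕ) * a))) ≤
        (boltzmann N (b N) (H N) μ₀).map (empirical N) G := by
    intro ν hν e he hkl δ hδ κ hκ hev
    have hNlim : Tendsto (fun N : ℕ+ => κ * ((N : ℕ) : ℝ)) atTop atTop :=
      (tendsto_natCast_atTop_atTop.comp tendsto_PNat_val_atTop_atTop).const_mul_atTop hκ
    filter_upwards [eventually_le_boltzmann h1 h2 hH_meas hH_symm hE_bot he hkl hδ hG hν, hev,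
      hNlim.eventually_ge_atTop 3] with N hN h4 h5
    rw [map_empirical_apply _ _ hG]
    refine le_trans (ENNReal.ofReal_le_ofReal ?_) (hN (b N) (hb_pos N).le)
    have hN0 : (0 : ℝ) < (N : ℕ) := by exact_mod_cast N.pos
    set d := (klDiv (ν : Measure X) μ₀).toReal
    rw [le_div_iff₀ (by norm_num)]
    have h6 : (4 : ℝ) ≤ Real.exp (κ * (N : ℕ)) := by
      linarith [Real.add_one_le_exp (κ * ((N : ℕ) : ℝ))]
    calc Real.exp (-(b N * (N : ℕ) * a)) * 4
        ≤ Real.exp (-(b N * (N : ℕ) * a)) * Real.exp (κ * (N : ℕ)) := by gcongr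
      _ ≤ Real.exp (-(b N * ((N : ℕ) * (e + δ))) - (N : ℕ) * (d + δ)) := by
        rw [← Real.exp_add, Real.exp_le_exp]
        nlinarith
  by_cases hβ : β = ⊤
  · simp only [freeEnergy, if_pos hβ, add_zero] at ha
    obtain ⟨m, hm, hmk, hmE⟩ := h3 hβ μ (ha.trans (EReal.coe_lt_top a))
    obtain ⟨j, hjG, hjE⟩ := ((hm.eventually (hG.mem_nhds hμ)).and
      (hmE.eventually_lt_const ha)).exists
    obtain ⟨e, he⟩ : ∃ e : ℝ, E (m j) = e := ⟨(E (m j)).toReal,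
      (EReal.coe_toReal (hjE.trans (EReal.coe_lt_top a)).ne (hE_bot _)).symm⟩
    have hea : e < a := by rw [he] at hjE; exact_mod_cast hjE
    refine key (m j) hjG e he (hmk j).2.ne ((a - e) / 2) (by linarith) 1 one_pos ?_
    have hb' : Tendsto b atTop atTop := EReal.tendsto_coe_nhds_top_iff.1 (hβ ▸ hb_lim)
    have hlim : Tendsto (fun N => b N * ((a - e) / 2)) atTop atTop :=
      hb'.atTop_mul_const (by linarith)
    filter_upwards [hlim.eventually_ge_atTop
      (1 + ((klDiv (m j : Measure X) μ₀).toReal + (a - e) / 2))] with N hN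
    linarith
  · obtain ⟨t, rfl⟩ : ∃ t : ℝ, β = t :=
      ⟨β.toReal, (EReal.coe_toReal hβ (bot_lt_of_lt hβ_pos).ne').symm⟩
    have ht : 0 < t := by exact_mod_cast hβ_pos
    have hb' : Tendsto b atTop (𝓝 t) := EReal.tendsto_coe.1 hb_lim
    simp only [freeEnergy, if_neg hβ] at ha
    have hkl : klDiv (μ : Measure X) μ₀ ≠ ⊤ := by
      intro h
      rw [h, EReal.coe_ennreal_top, EReal.top_div_of_pos_ne_top hβ_pos hβ,
        EReal.add_top_of_ne_bot (hE_bot μ)] at ha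
      exact not_top_lt ha
    obtain ⟨e, he⟩ : ∃ e : ℝ, E μ = e := by
      refine ⟨(E μ).toReal, (EReal.coe_toReal (fun h => ?_) (hE_bot _)).symm⟩
      rw [h, ← EReal.coe_ennreal_toReal hkl, ← EReal.coe_div, EReal.top_add_coe] at ha
      exact not_top_lt ha
    set d := (klDiv (μ : Measure X) μ₀).toReal with hd
    rw [he, ← EReal.coe_ennreal_toReal hkl, ← EReal.coe_div, ← EReal.coe_add,
      EReal.coe_lt_coe_iff] at ha
    set s := t * (a - e) - d with hs
    have hspos : 0 < s := by
      have : d / t < a - e := by linarith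
      rw [div_lt_iff₀ ht] at this
      linarith
    -- this `δ` turns the margin `s` into `s / 2`
    set δ := s / (2 * (t + 1)) with hδ
    have hδpos : 0 < δ := by positivity
    have hδs : δ * (t + 1) = s / 2 := by rw [hδ]; field_simp
    refine key μ hμ e he hkl δ hδpos (s / 4) (by linarith) ?_
    have hlim : Tendsto (fun N => b N * (a - e - δ) - (d + δ)) atTop
        (𝓝 (t * (a - e - δ) - (d + δ))) := (hb'.mul_const _).sub_const _
    refine (hlim.eventually_const_lt ?_).mono fun N h => h.le
    nlinarith

theorem tendsto_speed (hβ_pos : 0 < β) (hb_lim : Tendsto (fun N => (b N : EReal)) atTop (𝓝 β)) :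
    Tendsto (fun N : ℕ+ => b N * (N : ℕ)) atTop atTop := by
  obtain ⟨c, hc, hcβ⟩ := EReal.lt_iff_exists_real_btwn.1 hβ_pos
  have hc' : 0 < c := by exact_mod_cast hc
  have hNlim : Tendsto (fun N : ℕ+ => c * ((N : ℕ) : ℝ)) atTop atTop :=
    (tendsto_natCast_atTop_atTop.comp tendsto_PNat_val_atTop_atTop).const_mul_atTop hc'
  refine tendsto_atTop_mono' _ ?_ hNlim
  filter_upwards [hb_lim.eventually_const_lt hcβ] with N hN
  have : c < b N := by exact_mod_cast hN
  gcongr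

end Bounds

end GibbsLDP

theorem theorem1p1 {X : Type*} [TopologicalSpace X] [CompactSpace X]
    [TopologicalSpace.MetrizableSpace X] [MeasurableSpace X] [BorelSpace X]
    (μ₀ : ProbabilityMeasure X)
    (H : (N : ℕ+) → (Fin (N : ℕ) → X) → EReal)
    (hH_meas : ∀ N, Measurable (H N))
    (hH_symm : ∀ (N : ℕ+) (σ : Equiv.Perm (Fin (N : ℕ))) (x : Fin (N : ℕ) → X),
      H N (x ∘ σ) = H N x)
    (hH_bot : ∀ N x, H N x ≠ ⊥)
    (E : ProbabilityMeasure X → EReal) (hE_bot : ∀ μ, E μ ≠ ⊥)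
    (h1 : GibbsLDP.HypH1 H μ₀ E) (h2 : GibbsLDP.HypH2 H E)
    (b : ℕ+ → ℝ) (hb_pos : ∀ N, 0 < b N)
    (β : EReal) (hβ_pos : 0 < β) (hb_lim : Tendsto (fun N => (b N : EReal)) atTop (𝓝 β))
    (h3 : β = ⊤ → GibbsLDP.HypH3 μ₀ E) :
    GibbsLDP.SatisfiesLDP
        (fun N => (GibbsLDP.boltzmann N (b N) (H N) μ₀).map (GibbsLDP.empirical N))
        (fun N => b N * (N : ℕ))
        (GibbsLDP.freeEnergy μ₀ E β) ∧
      GibbsLDP.SatisfiesLDP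
        (fun N => (GibbsLDP.gibbs N (b N) (H N) μ₀).map (GibbsLDP.empirical N))
        (fun N => b N * (N : ℕ))
        (fun μ => GibbsLDP.freeEnergy μ₀ E β μ - ⨅ ν, GibbsLDP.freeEnergy μ₀ E β ν) := by
  have : Nonempty (ProbabilityMeasure X) := ⟨μ₀⟩
  have hU := GibbsLDP.localUpper_boltzmann (μ₀ := μ₀) h2 hH_symm hb_pos hβ_pos hb_lim
  have hL := GibbsLDP.localLower_boltzmann h1 h2 hH_meas hH_symm hE_bot hb_pos hβ_pos hb_lim h3
  have hr := GibbsLDP.tendsto_speed hβ_pos hb_lim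
  have hbot := GibbsLDP.freeEnergy_ne_bot (μ₀ := μ₀) hE_bot hβ_pos
  refine ⟨GibbsLDP.satisfiesLDP_of_local hU hL hr hbot, ?_⟩
  simp only [GibbsLDP.map_gibbs]
  exact GibbsLDP.satisfiesLDP_normalized_of_local hU hL hr hbot
    ⟨μ₀, GibbsLDP.freeEnergy_self_lt_top h1.2⟩
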